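/- A graphon is a measurable symmetric function $W:[0,1]^2\to[0,1]$. Its eigenvalues $\lambda_i(T_W)$, $i\in\mathbb Z\setminus\{0\}$, are those of the integral operator $(T_WX)(v)=\int_0^1W(u,v)X(u)\,du$ on $L^2([0,1])$, with multiplicity and padded by zeros, ordered as $\lambda_1\ge\lambda_2\ge\dots\ge0\ge\dots\ge\lambda_{-2}\ge\lambda_{-1}$. For $c>0$ put $$B^c_W=\#\{i:|\lambda_i(T_W)|\ge c\},\qquad \delta^c_{WW'}=\min_{i,\;j\ne i}\{|\lambda_i(T_{W'})-\lambda_j(T_W)|:|\lambda_i(T_{W'})|\ge c\},$$ where the minimum over the empty set is $+\infty$. The graphon induced by a graph on $n$ nodes with symmetric adjacency matrix $S\in[0,1]^{n\times n}$ is the step function equal to $[S]_{ij}$ on $I_i\times I_j$, where $I_1,\dots,I_n$ is the regular partition of $[0,1]$ into $n$ intervals of length $1/n$. For real coefficients $h_0,\dots,h_{K-1}$ put $h(\lambda)=\sum_{k<K}h_k\lambda^k$, and let the graph filter be $\Phi(x;h,S)=\sum_{k<K}h_k(S/n)^kx$ for $x\in\mathbb R^n$. Norms on $\mathbb R^n$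 are Euclidean. **Lemma 1 (graph filter transferability from weighted to stochastic graphs).** Let $W$ be a graphon with $|W(u_2,v_2)-W(u_1,v_1)|\le A_w(|u_2-u_1|+|v_2-v_1|)$ for all arguments, and let $X:[0,1]\to\mathbb R$ be $A_x$-Lipschitz. Let $0<c\le1$, and let $h$ be $A_h$-Lipschitz on $[-1,-c]\cup[c,1]$ and $a_h$-Lipschitz on $(-c,c)$, with $a_h<A_h$, and $|h(\lambda)|<1$ for $\lambda\in[-1,1]$. Let $\chi_3\in(0,1)$, let $d_W=\max_u\int_0^1W(u,v)\,dv>0$, and let $n$ satisfy $$n-\frac{\log(2n/\chi_3)}{d_W}>\frac{2A_w}{d_W}.$$ Let $u_1,\dots,u_n$ be independent and uniform on $[0,1]$, let $\bar S=[W(u_i,u_j)]_{ij}$ be the adjacency matrix of the weighted graph, and let $S$ be the symmetric $0/1$ adjacency matrix of a stochastic graph sampled from it: given the labels, the entries $[S]_{ij}=[S]_{ji}$, $i\le j$, are independent and $\mathrm{Bernoulli}([\bar S]_{ij})$. Put $[x]_i=X(u_i)$, $\bar y=\Phi(x;h,\bar S)$ and $y=\Phi(x;h,S)$, and let $\overline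 W_n$ and $W_n$ be the graphons induced by $\bar S$ and $S$. Then with probability at least $1-\chi_3$ $$\|\bar y-y\|\le\left(A_h+\frac{\pi B^c_{W_n}}{\delta^c_{\overline W_nW_n}}\right)2\sqrt{\frac{\log(2n/\chi_3)}{n}}\,\|x\|+2a_hc\,\|x\|,$$ where the right-hand side is read as $+\infty$ (the inequality is void) if $\delta^c_{\overline W_nW_n}=0$, and the quotient as $0$ if $B^c_{W_n}=0$. The same lower bound holds for the conditional probability given any event $\{(u_1,\dots,u_n)\in A\}$ of positive probability, with $A\subseteq[0,1]^n$ Borel. -/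

import Mathlib

open MeasureTheory ProbabilityTheory Set
open scoped ENNReal unitInterval

noncomputable section

/-! ### Graphons and their shift operators -/

/-- A graphon: a measurable symmetric kernel `[0,1]² → [0,1]`. -/
structure Graphon where
  /-- the kernel -/
  toFun : I → I → ℝ
  measurable' : Measurable (Function.uncurry toFun)
  symm' : ∀ u v, toFun u v = toFun v u
  mem' : ∀ u v, toFun u v ∈ Icc (0 : ℝ) 1

instance : CoeFun Graphon (fun _ => I → I → ℝ) := ⟨Graphon.toFun⟩

/-- The Hilbert space `L²([0,1])`, for Lebesgue measure. -/
abbrev L2I : Type := Lp ℝ 2 (volume : Measure I)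

namespace Graphon

theorem integrable_mul (W : Graphon) (f : L2I) (v : I) :
    Integrable (fun u => W u v * f u) := by
  have hf : Integrable (f : I → ℝ) := (Lp.memLp f).integrable (by norm_num)
  refine hf.bdd_mul (c := 1) ?_ (Filter.Eventually.of_forall fun u => ?_)
  · exact (W.measurable'.comp (measurable_id.prodMk measurable_const)).aestronglyMeasurable
  · rw [Real.norm_eq_abs, abs_of_nonneg (W.mem' u v).1]
    exact (W.mem' u v).2

theorem memLp_shift (W : Graphon) (f : L2I) :
    MemLp (fun v => ∫ u, W u v * f u) 2 (volume : Measure I) := by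
  have hf : Integrable (f : I → ℝ) := (Lp.memLp f).integrable (by norm_num)
  have hm : StronglyMeasurable (fun p : I × I => W p.2 p.1 * f p.2) :=
    ((W.measurable'.comp measurable_swap).stronglyMeasurable).mul
      ((Lp.stronglyMeasurable f).comp_measurable measurable_snd)
  refine MemLp.of_bound (hm.integral_prod_right').aestronglyMeasurable (∫ u, ‖f u‖)
    (Filter.Eventually.of_forall fun v => ?_)
  refine norm_integral_le_of_norm_le hf.norm (Filter.Eventually.of_forall fun u => ?_)
  rw [norm_mul, Real.norm_eq_abs, abs_of_nonneg (W.mem' u v).1]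
  exact mul_le_of_le_one_left (norm_nonneg _) (W.mem' u v).2

/-- The graphon shift operator `(T_W X)(v) = ∫₀¹ W(u,v) X(u) du` on `L²([0,1])`. -/
def shift (W : Graphon) : Module.End ℝ L2I where
  toFun f := (W.memLp_shift f).toLp _
  map_add' f g := by
    rw [← MemLp.toLp_add]
    refine MemLp.toLp_congr _ _ (Filter.Eventually.of_forall fun v => ?_)
    simp only [Pi.add_apply]
    rw [← integral_add (W.integrable_mul f v) (W.integrable_mul g v)]
    refine integral_congr_ae ?_
    filter_upwards [Lp.coeFn_add f g] with u hu
    rw [hu, Pi.add_apply, mul_add]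
  map_smul' r f := by
    rw [RingHom.id_apply, ← MemLp.toLp_const_smul]
    refine MemLp.toLp_congr _ _ (Filter.Eventually.of_forall fun v => ?_)
    simp only [Pi.smul_apply, smul_eq_mul]
    rw [← integral_const_mul]
    refine integral_congr_ae ?_
    filter_upwards [Lp.coeFn_smul r f] with u hu
    rw [hu, Pi.smul_apply, smul_eq_mul]
    ring

end Graphon

/-! ### Eigenvalues ordered by sign and magnitude -/

/-- The `k`-th largest positive eigenvalue (`k ≥ 1`) of `T`, counted with multiplicity, and `0` if
`T` has fewer than `k` positive eigenvalues: the largest `t > 0` such that the eigenspaces for the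
eigenvalues `≥ t` together have dimension at least `k`. Meant for compact self-adjoint `T`. -/
def posEigenvalue {E : Type*} [AddCommGroup E] [Module ℝ E] (T : Module.End ℝ E) (k : ℕ) : ℝ :=
  sSup {t : ℝ | t = 0 ∨
    (0 < t ∧ (k : Cardinal) ≤ Module.rank ℝ ↥(⨆ s ∈ Ici t, T.eigenspace s))}

namespace Graphon

/-- The eigenvalues `λ_i(T_W)`, `i ∈ ℤ \ {0}`, with multiplicity, in the order
`λ_1 ≥ λ_2 ≥ … ≥ 0 ≥ … ≥ λ_{-2} ≥ λ_{-1}`. The value at `i = 0` is never used. -/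
def eigenvalue (W : Graphon) (i : ℤ) : ℝ :=
  if 0 < i then posEigenvalue W.shift i.natAbs else -posEigenvalue (-W.shift) i.natAbs

/-- The `c`-band cardinality `B^c_W = #{λ_i : |λ_i| ≥ c}`. -/
def bandCard (W : Graphon) (c : ℝ) : ℕ∞ :=
  {i : ℤ | i ≠ 0 ∧ c ≤ |W.eigenvalue i|}.encard

/-- The `c`-eigenvalue margin
`δ^c_{WW'} = min_{i, j ≠ i} {|λ_i(T_{W'}) - λ_j(T_W)| : |λ_i(T_{W'})| ≥ c}`;
it is `∞` if no eigenvalue of `W'` satisfies the constraint. -/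
def eigenvalueMargin (W W' : Graphon) (c : ℝ) : ℝ≥0∞ :=
  ⨅ (i : ℤ) (j : ℤ) (_ : i ≠ 0 ∧ j ≠ 0 ∧ j ≠ i ∧ c ≤ |W'.eigenvalue i|),
    ENNReal.ofReal |W'.eigenvalue i - W.eigenvalue j|

/-- The maximum degree `d_W = max_u ∫₀¹ W(u,v) dv`. -/
def maxDegree (W : Graphon) : ℝ := ⨆ u : I, ∫ v : I, W u v

end Graphon

/-! ### Graphs and the graphons they induce -/

/-- An undirected graph on `n` nodes (loops allowed) with edge weights in `[0,1]`, given by its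
adjacency matrix, which is its graph shift operator. -/
structure NodeGraph (n : ℕ) where
  /-- the graph shift operator -/
  adj : Matrix (Fin n) (Fin n) ℝ
  symm' : ∀ i j, adj i j = adj j i
  mem' : ∀ i j, adj i j ∈ Icc (0 : ℝ) 1

/-- The interval `[i/n, (i+1)/n)` (`0 ≤ i < n`), closed at `1` if it is the last one. -/
def cell (n : ℕ) (i : Fin n) : Set I :=
  {t | (i : ℝ) / n ≤ (t : ℝ) ∧ ((t : ℝ) < ((i : ℝ) + 1) / n ∨ (i : ℕ) + 1 = n)}

theorem measurableSet_cell (n : ℕ) (i : Fin n) : MeasurableSet (cell n i) := by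
  refine (measurableSet_le measurable_const measurable_subtype_coe).inter ?_
  exact (measurableSet_lt measurable_subtype_coe measurable_const).union (MeasurableSet.const _)

theorem cell_disjoint {n : ℕ} {i j : Fin n} (hij : i < j) {t : I} (hi : t ∈ cell n i)
    (hj : t ∈ cell n j) : False := by
  have hn : (0 : ℝ) < n := by exact_mod_cast (Nat.zero_le _).trans_lt i.2
  have h1 : (i : ℕ) + 1 ≤ j := hij
  have h2 : ((i : ℝ) + 1) ≤ (j : ℝ) := by exact_mod_cast h1
  rcases hi.2 with h | h
  · exact absurd (hj.1.trans_lt h) (not_lt.2 (div_le_div_of_nonneg_right h2 hn.le))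
  · have := j.2
    omega

theorem sum_cell_le_one (n : ℕ) (t : I) :
    ∑ i : Fin n, (cell n i).indicator (fun _ => (1 : ℝ)) t ≤ 1 := by
  classical
  by_cases h : ∃ i : Fin n, t ∈ cell n i
  · obtain ⟨i, hi⟩ := h
    rw [Finset.sum_eq_single i]
    · simp [hi]
    · intro j _ hj
      refine indicator_of_notMem (fun hjt => ?_) _
      rcases lt_or_gt_of_ne hj with h | h
      · exact cell_disjoint h hjt hi
      · exact cell_disjoint h hi hjt
    · simp
  · push Not at h
    rw [Finset.sum_eq_zero fun i _ => indicator_of_notMem (h i) _]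
    exact zero_le_one

namespace NodeGraph

/-- The graphon induced by a graph: `W_G(u,v) = ∑ᵢ ∑ⱼ [S]ᵢⱼ 1(u ∈ Iᵢ) 1(v ∈ Iⱼ)`, where
`I_1, …, I_n` is the regular partition of `[0,1]`. -/
def inducedGraphon {n : ℕ} (G : NodeGraph n) : Graphon where
  toFun u v := ∑ i, ∑ j, G.adj i j * (cell n i).indicator (fun _ => (1 : ℝ)) u *
    (cell n j).indicator (fun _ => (1 : ℝ)) v
  measurable' := by
    refine Finset.measurable_sum _ fun i _ => Finset.measurable_sum _ fun j _ => ?_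
    exact (((measurable_const.indicator (measurableSet_cell n i)).comp
      measurable_fst).const_mul _).mul
        ((measurable_const.indicator (measurableSet_cell n j)).comp measurable_snd)
  symm' u v := by
    rw [Finset.sum_comm]
    refine Finset.sum_congr rfl fun i _ => Finset.sum_congr rfl fun j _ => ?_
    rw [G.symm' j i]
    ring
  mem' u v := by
    have h0 : ∀ (i : Fin n) (t : I), 0 ≤ (cell n i).indicator (fun _ => (1 : ℝ)) t :=
      fun i t => indicator_nonneg (fun _ _ => zero_le_one) t
    refine ⟨Finset.sum_nonneg fun i _ => Finset.sum_nonneg fun j _ =>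
      mul_nonneg (mul_nonneg (G.mem' i j).1 (h0 i u)) (h0 j v), ?_⟩
    calc _ ≤ ∑ i, ∑ j, (cell n i).indicator (fun _ => (1 : ℝ)) u *
          (cell n j).indicator (fun _ => (1 : ℝ)) v := by
          refine Finset.sum_le_sum fun i _ => Finset.sum_le_sum fun j _ => ?_
          exact mul_le_mul_of_nonneg_right
            (mul_le_of_le_one_left (h0 i u) (G.mem' i j).2) (h0 j v)
      _ = (∑ i, (cell n i).indicator (fun _ => (1 : ℝ)) u) *
          ∑ j, (cell n j).indicator (fun _ => (1 : ℝ)) v := by rw [Finset.sum_mul_sum]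
      _ ≤ 1 := mul_le_one₀ (sum_cell_le_one n u) (Finset.sum_nonneg fun j _ => h0 j v)
          (sum_cell_le_one n v)

end NodeGraph

/-! ### Random graphs sampled from a graphon -/

/-- The weighted graph of `W` at node labels `u`: `[S]ᵢⱼ = W(uᵢ, uⱼ)`. -/
def weightedGraph {n : ℕ} (W : Graphon) (u : Fin n → I) : NodeGraph n where
  adj i j := W (u i) (u j)
  symm' _ _ := W.symm' _ _
  mem' _ _ := W.mem' _ _

/-- `U` consists of `n` independent labels, uniformly distributed on `[0,1]`. -/
structure IsUniformSample {Ω : Type*} [MeasurableSpace Ω] (P : Measure Ω) {n : ℕ}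
    (U : Ω → Fin n → I) : Prop where
  measurable : ∀ i, Measurable fun ω => U ω i
  uniform : ∀ i, P.map (fun ω => U ω i) = (volume : Measure I)
  indep : iIndepFun (fun i ω => U ω i) P

/-- `G` is a stochastic graph sampled from the weighted graph of `W` at the random labels `U`:
an unweighted graph such that, conditionally on the labels, the `[S]ᵢⱼ = [S]ⱼᵢ`, `i ≤ j`, are
independent and Bernoulli with parameter the weight `W(Uᵢ, Uⱼ)`. That is, the joint law of `U` and
`G` is: the probability of `U ∈ A` and of a given 0/1 pattern `e` of `G` is the integral over
`U ∈ A` of the product of the Bernoulli probabilities of the entries of the pattern. -/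
structure IsStochasticGraph {Ω : Type*} [MeasurableSpace Ω] (P : Measure Ω) {n : ℕ}
    (W : Graphon) (U : Ω → Fin n → I) (G : Ω → NodeGraph n) : Prop where
  measurable : ∀ i j, Measurable fun ω => (G ω).adj i j
  unweighted : ∀ ω i j, (G ω).adj i j = 0 ∨ (G ω).adj i j = 1
  bernoulli : ∀ A : Set (Fin n → I), MeasurableSet A → ∀ e : Fin n → Fin n → Bool,
    P {ω | U ω ∈ A ∧ ∀ i j, i ≤ j → (G ω).adj i j = if e i j then 1 else 0} =
      ∫⁻ ω in {ω | U ω ∈ A}, ∏ p ∈ Finset.univ.filter (fun p : Fin n × Fin n => p.1 ≤ p.2),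
        ENNReal.ofReal (if e p.1 p.2 then (weightedGraph W (U ω)).adj p.1 p.2
          else 1 - (weightedGraph W (U ω)).adj p.1 p.2) ∂P

/-- The graph signal `[x]ᵢ = X(uᵢ)` instantiated from a graphon signal `X`. -/
def graphSignal {n : ℕ} (X : I → ℝ) (u : Fin n → I) : EuclideanSpace ℝ (Fin n) :=
  WithLp.toLp 2 fun i => X (u i)

/-! ### Filters -/

/-- The spectral response `h(λ) = ∑ₖ hₖ λᵏ`. -/
def spectralResponse {K : ℕ} (h : Fin K → ℝ) (l : ℝ) : ℝ := ∑ k, h k * l ^ (k : ℕ)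

/-- The graph filter `Φ(x; h, S) = ∑ₖ hₖ (S/n)ᵏ x`, with the shift operator normalized by the
number of nodes; it equals `V h(Λ/n) Vᴴ x` if `S = V Λ Vᴴ`. -/
def graphFilter {K n : ℕ} (h : Fin K → ℝ) (G : NodeGraph n) (x : EuclideanSpace ℝ (Fin n)) :
    EuclideanSpace ℝ (Fin n) :=
  WithLp.toLp 2 (∑ k, h k • (((n : ℝ)⁻¹ • G.adj) ^ (k : ℕ)).mulVec x.ofLp)

/-! ### Assumptions -/

/-- The graphon is `A`-Lipschitz. -/
def Graphon.IsLipschitz (W : Graphon) (A : ℝ) : Prop :=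
  ∀ u₁ v₁ u₂ v₂ : I,
    |W u₂ v₂ - W u₁ v₁| ≤ A * (|(u₂ : ℝ) - u₁| + |(v₂ : ℝ) - v₁|)

/-- The graphon signal is `A`-Lipschitz. -/
def SignalIsLipschitz (X : I → ℝ) (A : ℝ) : Prop :=
  ∀ u v : I, |X u - X v| ≤ A * |(u : ℝ) - v|

/-- The spectral response `h` is `A`-Lipschitz on `[-1,-c] ∪ [c,1]` and `a`-Lipschitz on `(-c,c)`,
with `a < A`, and `|h| < 1` on the spectral range `[-1,1]`. -/
structure FilterCondition (h : ℝ → ℝ) (A a c : ℝ) : Prop where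
  outer : ∀ l ∈ Icc (-1) (-c) ∪ Icc c 1, ∀ l' ∈ Icc (-1) (-c) ∪ Icc c 1,
    |h l - h l'| ≤ A * |l - l'|
  inner : ∀ l ∈ Ioo (-c) c, ∀ l' ∈ Ioo (-c) c, |h l - h l'| ≤ a * |l - l'|
  lt : a < A
  bounded : ∀ l ∈ Icc (-1 : ℝ) 1, |h l| < 1

/-- The graph is large enough: `n - log(2n/χ)/d_W > 2 A/d_W`, where `d_W > 0`. -/
def SizeCondition (W : Graphon) (A χ : ℝ) (n : ℕ) : Prop :=
  0 < W.maxDegree ∧ (n : ℝ) - Real.log (2 * n / χ) / W.maxDegree > 2 * (A / W.maxDegree)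

/-- The bound
`‖y - y'‖ ≤ (A + π B^c_{W'} / δ^c_{WW'}) 2 √(log(2n/χ)/n) ‖x‖ + 2 a c ‖x‖`
between the outputs `y`, `y'` of the filter `h` with input `x` on the graphs `G`, `G'`, where `W`
and `W'` are the graphons induced by `G` and `G'`. It is an inequality in `[0,∞]`: it is void if
`δ = 0`, and the quotient is `0` if `W'` has no eigenvalue of modulus `≥ c` (then `B = 0`,
`δ = ∞`). -/
def TransferBound {K n : ℕ} (h : Fin K → ℝ) (A a c χ : ℝ) (G G' : NodeGraph n)
    (x : EuclideanSpace ℝ (Fin n)) : Prop :=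
  ENNReal.ofReal ‖graphFilter h G x - graphFilter h G' x‖ ≤
    (ENNReal.ofReal A + ENNReal.ofReal Real.pi * (G'.inducedGraphon.bandCard c : ℝ≥0∞) /
        G.inducedGraphon.eigenvalueMargin G'.inducedGraphon c) *
      ENNReal.ofReal (2 * √(Real.log (2 * n / χ) / n)) * ENNReal.ofReal ‖x‖ +
    ENNReal.ofReal (2 * a * c * ‖x‖)

end

/-! Randomness enters only through one estimate: given the labels, the operator norm of `S - S̄` is
at most `2 √(n log(2n/χ))` outside an event of conditional probability at most `χ`. After division
by `n` the normalized shifts differ by at most `ε = 2 √(log(2n/χ)/n)`, and the rest is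
deterministic. Since the estimate is integrated over an arbitrary label event, it also gives the
conditional statement.

Deterministic part (`transferBound_of_norm_sub_le`). The operator of an induced graphon maps into
the step functions and acts on them as the adjacency matrix divided by `n`, so its nonzero
eigenvalues are those of that matrix (`rank_iSup_eigenspace`). Let `l`, `m` be the ordered
eigenvalues for `S̄`, `S`, and let `J` be the indices with `|m i| ≥ c`. In `norm_diagonalOp_sub_le`
both filters are compared with operators having equal diagonal values on `J`. Moving the eigenvalues
costs `A ε` by Weyl's inequality. Moving the eigenvectors in `J` costs `2 ε/δ` each by Davis–Kahan,
because `|h| < 1`; finally `2 ≤ π`. Outside `J` each filter is within `a c` of the constant `h 0`,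
whence `2 a c`.

Concentration (`sum_bernoulliWeight_filter_le`). For fixed `x` the form `⟨x, (S - S̄) x⟩` is a sum
of independent centered terms, sub-Gaussian by Hoeffding's lemma. If the operator norm exceeds `t`,
the form is at least `47/64 t` in modulus on a whole ball of radius `1/8` around a unit eigenvector.
Integrating the exponential moment over the ball of radius `9/8` therefore replaces a union over a
net, at the cost of the volume ratio `9 ^ n`. -/

noncomputable section

/-! ### Spectral perturbation of self-adjoint operators in finite dimension -/

section Spectral

variable {E : Type*} [NormedAddCommGroup E] [InnerProductSpace ℝ E] {n : ℕ}

/-- The operator which is diagonal in the orthonormal basis `b`, with diagonal entries `g`. -/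
def diagonalOp (b : OrthonormalBasis (Fin n) ℝ E) (g : Fin n → ℝ) (x : E) : E :=
  ∑ i, (g i * inner ℝ (b i) x) • b i

theorem inner_diagonalOp (b : OrthonormalBasis (Fin n) ℝ E) (g : Fin n → ℝ) (x : E) (j : Fin n) :
    inner ℝ (b j) (diagonalOp b g x) = g j * inner ℝ (b j) x := by
  rw [diagonalOp, b.orthonormal.inner_right_fintype]

theorem diagonalOp_add (b : OrthonormalBasis (Fin n) ℝ E) (g g' : Fin n → ℝ) (x : E) :
    diagonalOp b (g + g') x = diagonalOp b g x + diagonalOp b g' x := by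
  simp only [diagonalOp, ← Finset.sum_add_distrib, ← add_smul, Pi.add_apply, add_mul]

theorem diagonalOp_const (b : OrthonormalBasis (Fin n) ℝ E) (r : ℝ) (x : E) :
    diagonalOp b (fun _ => r) x = r • x := by
  conv_rhs => rw [← b.sum_repr' x, Finset.smul_sum]
  simp only [diagonalOp, mul_smul]

theorem norm_sq_eq_sum_inner_sq (b : OrthonormalBasis (Fin n) ℝ E) (x : E) :
    ‖x‖ ^ 2 = ∑ i, inner ℝ (b i) x ^ 2 := by
  rw [← b.sum_sq_norm_inner_right x]
  simp

theorem norm_diagonalOp_le (b : OrthonormalBasis (Fin n) ℝ E) {g : Fin n → ℝ} {C : ℝ}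
    (hC : 0 ≤ C) (hg : ∀ i, |g i| ≤ C) (x : E) : ‖diagonalOp b g x‖ ≤ C * ‖x‖ := by
  refine le_of_sq_le_sq ?_ (by positivity)
  rw [norm_sq_eq_sum_inner_sq b, mul_pow, norm_sq_eq_sum_inner_sq b x, Finset.mul_sum]
  refine Finset.sum_le_sum fun i _ => ?_
  rw [inner_diagonalOp, mul_pow]
  exact mul_le_mul_of_nonneg_right (sq_le_sq' (by linarith [neg_abs_le (g i), hg i])
    ((le_abs_self _).trans (hg i))) (sq_nonneg _)

theorem apply_eq_diagonalOp {b : OrthonormalBasis (Fin n) ℝ E} {l : Fin n → ℝ} {A : E →ₗ[ℝ] E}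
    (hA : ∀ i, A (b i) = l i • b i) (x : E) : A x = diagonalOp b l x := by
  conv_lhs => rw [← b.sum_repr' x, map_sum]
  refine Finset.sum_congr rfl fun i _ => ?_
  rw [map_smul, hA, smul_smul, mul_comm]

theorem inner_apply_of_eigenbasis {b : OrthonormalBasis (Fin n) ℝ E} {l : Fin n → ℝ}
    {A : E →ₗ[ℝ] E} (hA : ∀ i, A (b i) = l i • b i) (x : E) (j : Fin n) :
    inner ℝ (b j) (A x) = l j * inner ℝ (b j) x := by
  rw [apply_eq_diagonalOp hA, inner_diagonalOp]

theorem inner_apply_self_of_eigenbasis {b : OrthonormalBasis (Fin n) ℝ E} {l : Fin n → ℝ}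
    {A : E →ₗ[ℝ] E} (hA : ∀ i, A (b i) = l i • b i) (x : E) :
    inner ℝ x (A x) = ∑ i, l i * inner ℝ (b i) x ^ 2 := by
  rw [← b.sum_inner_mul_inner]
  refine Finset.sum_congr rfl fun i _ => ?_
  rw [inner_apply_of_eigenbasis hA, real_inner_comm]
  ring

/-- **Weyl's inequality** for eigenvalues in decreasing order. -/
theorem eigenvalue_le_add_of_norm_sub_le {v w : OrthonormalBasis (Fin n) ℝ E} {l m : Fin n → ℝ}
    {A B : E →ₗ[ℝ] E} (hA : ∀ i, A (v i) = l i • v i) (hB : ∀ i, B (w i) = m i • w i)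
    (hl : Antitone l) (hm : Antitone m) {ε : ℝ} (hε : ∀ x, ‖A x - B x‖ ≤ ε * ‖x‖) (k : Fin n) :
    l k ≤ m k + ε := by
  have : FiniteDimensional ℝ E := v.toBasis.finiteDimensional_of_finite
  -- These are `n - 1` linear conditions, so some nonzero `x` is orthogonal to `v i` for `i > k` and
  -- to `w i` for `i < k`. Its quadratic form is at least `l k ‖x‖²` for `A` and at most `m k ‖x‖²`
  -- for `B`.
  let f : E →ₗ[ℝ] ({i : Fin n // i ≠ k} → ℝ) :=
    LinearMap.pi fun i => if k < i then (innerₛₗ ℝ (v i)) else (innerₛₗ ℝ (w i))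
  have hf : LinearMap.ker f ≠ ⊥ := by
    apply LinearMap.ker_ne_bot_of_finrank_lt
    rw [Module.finrank_eq_card_basis v.toBasis, Module.finrank_fintype_fun_eq_card]
    simpa using Fintype.card_subtype_lt (p := fun i : Fin n => i ≠ k) (x := k) (by simp)
  obtain ⟨x, hx, hx0⟩ := (Submodule.ne_bot_iff _).1 hf
  have hfx : ∀ i, i ≠ k → (if k < i then inner ℝ (v i) x else inner ℝ (w i) x) = 0 := by
    intro i hi
    have := congrFun (LinearMap.mem_ker.1 hx) ⟨i, hi⟩
    simp only [f, LinearMap.pi_apply, Pi.zero_apply] at this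
    split_ifs at this ⊢ <;> simpa using this
  have h1 : l k * ‖x‖ ^ 2 ≤ inner ℝ x (A x) := by
    rw [inner_apply_self_of_eigenbasis hA, norm_sq_eq_sum_inner_sq v, Finset.mul_sum]
    refine Finset.sum_le_sum fun i _ => ?_
    rcases lt_or_ge k i with h | h
    · have := hfx i h.ne'
      rw [if_pos h] at this
      simp [this]
    · exact mul_le_mul_of_nonneg_right (hl h) (sq_nonneg _)
  have h2 : inner ℝ x (B x) ≤ m k * ‖x‖ ^ 2 := by
    rw [inner_apply_self_of_eigenbasis hB, norm_sq_eq_sum_inner_sq w, Finset.mul_sum]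
    refine Finset.sum_le_sum fun i _ => ?_
    rcases lt_or_ge i k with h | h
    · have := hfx i h.ne
      rw [if_neg (not_lt.2 h.le)] at this
      simp [this]
    · exact mul_le_mul_of_nonneg_right (hm h) (sq_nonneg _)
  have h3 : inner ℝ x (A x) - inner ℝ x (B x) ≤ ε * ‖x‖ ^ 2 := by
    rw [← inner_sub_right]
    calc _ ≤ ‖x‖ * ‖A x - B x‖ := real_inner_le_norm _ _
      _ ≤ ‖x‖ * (ε * ‖x‖) := mul_le_mul_of_nonneg_left (hε x) (norm_nonneg _)
      _ = _ := by ring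
  have h4 : 0 < ‖x‖ ^ 2 := pow_pos (norm_pos_iff.2 hx0) 2
  refine le_of_mul_le_mul_right ?_ h4
  linarith

theorem abs_eigenvalue_sub_le {v w : OrthonormalBasis (Fin n) ℝ E} {l m : Fin n → ℝ}
    {A B : E →ₗ[ℝ] E} (hA : ∀ i, A (v i) = l i • v i) (hB : ∀ i, B (w i) = m i • w i)
    (hl : Antitone l) (hm : Antitone m) {ε : ℝ} (hε : ∀ x, ‖A x - B x‖ ≤ ε * ‖x‖) (k : Fin n) :
    |l k - m k| ≤ ε := by
  have h1 := eigenvalue_le_add_of_norm_sub_le hA hB hl hm hε k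
  have h2 := eigenvalue_le_add_of_norm_sub_le hB hA hm hl
    (fun x => by rw [norm_sub_rev]; exact hε x) k
  rw [abs_le]
  constructor <;> linarith

/-- The **Davis–Kahan theorem** for a single eigenvector, as a bound on the squared sine of the
angle between the two eigenvectors. -/
theorem one_sub_inner_sq_le {v w : OrthonormalBasis (Fin n) ℝ E} {l m : Fin n → ℝ}
    {A B : E →ₗ[ℝ] E} (hA : ∀ i, A (v i) = l i • v i) (hB : ∀ i, B (w i) = m i • w i)
    {ε δ : ℝ} (hε : ∀ x, ‖A x - B x‖ ≤ ε * ‖x‖) (hδ : 0 < δ) (i : Fin n)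
    (hgap : ∀ j, j ≠ i → δ ≤ |m i - l j|) :
    1 - inner ℝ (v i) (w i) ^ 2 ≤ (ε / δ) ^ 2 := by
  have h1 : 1 = ∑ j, inner ℝ (v j) (w i) ^ 2 := by
    rw [← norm_sq_eq_sum_inner_sq v, w.norm_eq_one, one_pow]
  have h2 : ‖A (w i) - B (w i)‖ ^ 2 ≤ ε ^ 2 := by
    have := hε (w i)
    rw [w.norm_eq_one, mul_one] at this
    gcongr
  -- The component of `(A - B) (w i)` along `v j` is `(l j - m i) ⟨v j, w i⟩`, and the gap bounds
  -- the first factor below for `j ≠ i`.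
  have h3 : ∑ j ∈ Finset.univ.erase i, inner ℝ (v j) (w i) ^ 2 * δ ^ 2 ≤ ε ^ 2 := by
    refine le_trans ?_ h2
    rw [norm_sq_eq_sum_inner_sq v]
    refine (Finset.sum_le_sum fun j hj => ?_).trans (Finset.sum_le_sum_of_subset_of_nonneg
      (Finset.erase_subset i Finset.univ) fun _ _ _ => sq_nonneg _)
    rw [inner_sub_right, inner_apply_of_eigenbasis hA, hB, inner_smul_right, ← sub_mul, mul_pow,
      mul_comm]
    refine mul_le_mul_of_nonneg_right ?_ (sq_nonneg _)
    rw [sq_le_sq, abs_of_pos hδ, abs_sub_comm]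
    exact hgap j (Finset.ne_of_mem_erase hj)
  rw [← Finset.sum_mul] at h3
  rw [div_pow, le_div_iff₀ (by positivity)]
  rw [← Finset.add_sum_erase _ _ (Finset.mem_univ i)] at h1
  calc _ = (∑ j ∈ Finset.univ.erase i, inner ℝ (v j) (w i) ^ 2) * δ ^ 2 := by
        rw [← sub_eq_iff_eq_add'.2 h1]
    _ ≤ _ := h3

/-- The difference of the orthogonal projections onto two lines has norm the sine of the angle. -/
theorem norm_projection_sub_le {v w : E} (hv : ‖v‖ = 1) (hw : ‖w‖ = 1) {s : ℝ} (hs : 0 ≤ s)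
    (h : 1 - inner ℝ v w ^ 2 ≤ s ^ 2) (x : E) :
    ‖(inner ℝ v x : ℝ) • v - (inner ℝ w x : ℝ) • w‖ ≤ s * ‖x‖ := by
  refine le_of_sq_le_sq ?_ (by positivity)
  set a : ℝ := inner ℝ v x with ha
  set b : ℝ := inner ℝ w x with hb
  set t : ℝ := inner ℝ v w with ht
  have e1 : ‖a • v - b • w‖ ^ 2 = a ^ 2 + b ^ 2 - 2 * (a * b * t) := by
    rw [norm_sub_sq_real, norm_smul, norm_smul, hv, hw, inner_smul_left, inner_smul_right, ← ht]
    simp only [Real.norm_eq_abs, mul_one, sq_abs, conj_trivial]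
    ring
  have e2 : ‖w - t • v‖ ^ 2 = 1 - t ^ 2 := by
    rw [norm_sub_sq_real, norm_smul, hv, hw, inner_smul_right, real_inner_comm, ← ht]
    simp only [Real.norm_eq_abs, mul_one, sq_abs]
    ring
  have e3 : ‖x - a • v‖ ^ 2 = ‖x‖ ^ 2 - a ^ 2 := by
    rw [norm_sub_sq_real, norm_smul, hv, inner_smul_right, real_inner_comm, ← ha]
    simp only [Real.norm_eq_abs, mul_one, sq_abs]
    ring
  have e4 : inner ℝ (w - t • v) (x - a • v) = b - t * a := by
    have hvv : inner ℝ v v = (1 : ℝ) := by rw [real_inner_self_eq_norm_sq, hv, one_pow]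
    have hwv : inner ℝ w v = t := by rw [real_inner_comm]
    simp only [inner_sub_left, inner_sub_right, inner_smul_left, inner_smul_right, hvv, hwv,
      ← ha, ← hb, conj_trivial]
    ring
  -- Cauchy–Schwarz for the parts of `w` and `x` orthogonal to `v`; it rearranges to `a² + b² - 2abt
  -- ≤ (1 - t²) ‖x‖²`.
  have e5 : (b - t * a) ^ 2 ≤ (1 - t ^ 2) * (‖x‖ ^ 2 - a ^ 2) := by
    rw [← e2, ← e3, ← e4, ← mul_pow, ← sq_abs]
    exact pow_le_pow_left₀ (abs_nonneg _) (abs_real_inner_le_norm _ _) 2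
  rw [e1]
  have := mul_le_mul_of_nonneg_right h (sq_nonneg ‖x‖)
  nlinarith

/-- Perturbation bound for a function of a self-adjoint operator, given in terms of eigenbases `v`,
`w` and eigenvalues `l`, `m`: the function is `a`-Lipschitz near `0` and `A`-Lipschitz globally, and
outside of the index set `J` the eigenvalues `m` are less than `c` in modulus. -/
theorem norm_diagonalOp_sub_le (v w : OrthonormalBasis (Fin n) ℝ E) {l m : Fin n → ℝ}
    {f : ℝ → ℝ} {A a c ε s : ℝ} (hc : 0 < c) (hc1 : c ≤ 1) (hs : 0 ≤ s) (hε : 0 ≤ ε) (hA : 0 ≤ A)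
    (hl1 : ∀ i, l i ∈ Icc (-1 : ℝ) 1) (hm1 : ∀ i, m i ∈ Icc (-1 : ℝ) 1)
    (hlip : ∀ x ∈ Icc (-1 : ℝ) 1, ∀ y ∈ Icc (-1 : ℝ) 1, |f x - f y| ≤ A * |x - y|)
    (hin : ∀ x ∈ Icc (-c) c, |f x - f 0| ≤ a * c)
    (hf : ∀ x ∈ Icc (-1 : ℝ) 1, |f x| < 1) (hlm : ∀ i, |l i - m i| ≤ ε) {J : Finset (Fin n)}
    (hJ : ∀ i ∉ J, |m i| < c) (hvw : ∀ i ∈ J, 1 - inner ℝ (v i) (w i) ^ 2 ≤ s ^ 2) (x : E) :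
    ‖diagonalOp v (fun i => f (l i)) x - diagonalOp w (fun i => f (m i)) x‖ ≤
      (A * ε + 2 * J.card * s + 2 * (a * c)) * ‖x‖ := by
  classical
  have hac : 0 ≤ a * c := (abs_nonneg _).trans (hin 0 ⟨by linarith, hc.le⟩)
  have h0 : (0 : ℝ) ∈ Icc (-1 : ℝ) 1 := by simp
  -- For `i ∉ J` the eigenvalue `l i` may still leave `[-c, c]`, where the bound `a * c` is not
  -- available. As `|m i| < c`, clamping moves `l i` by at most `|l i - m i| ≤ ε`, a cost absorbed
  -- in `g`.
  let clamp : ℝ → ℝ := fun t => max (-c) (min t c)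
  have hclamp : ∀ t, clamp t ∈ Icc (-c) c := fun t =>
    ⟨le_max_left _ _, max_le (by linarith) (min_le_right _ _)⟩
  let κ : Fin n → ℝ := fun i => if i ∈ J then f (m i) else f (clamp (l i))
  let g : Fin n → ℝ := fun i => f (l i) - κ i
  let gJ : Fin n → ℝ := fun i => if i ∈ J then f (m i) - f 0 else 0
  let r : Fin n → ℝ := fun i => if i ∈ J then 0 else f (clamp (l i)) - f 0
  let q : Fin n → ℝ := fun i => if i ∈ J then 0 else f (m i) - f 0
  have hg : ∀ i, |g i| ≤ A * ε := by
    intro i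
    simp only [g, κ]
    split_ifs with hi
    · exact (hlip _ (hl1 i) _ (hm1 i)).trans (mul_le_mul_of_nonneg_left (hlm i) hA)
    · have hcl := hclamp (l i)
      refine (hlip _ (hl1 i) _ ⟨by linarith [hcl.1], by linarith [hcl.2]⟩).trans
        (mul_le_mul_of_nonneg_left ?_ hA)
      have h1 := abs_lt.1 (hJ i hi)
      have h2 := abs_le.1 (hlm i)
      simp only [clamp]
      rw [abs_le]
      rcases le_total (l i) c with h | h
      · rw [min_eq_left h]
        rcases le_total (-c) (l i) with h' | h'
        · rw [max_eq_right h']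
          constructor <;> linarith
        · rw [max_eq_left h']
          constructor <;> linarith
      · rw [min_eq_right h, max_eq_right (by linarith)]
        constructor <;> linarith
  have hr : ∀ i, |r i| ≤ a * c := by
    intro i
    simp only [r]
    split_ifs
    · simpa using hac
    · exact hin _ (hclamp _)
  have hq : ∀ i, |q i| ≤ a * c := by
    intro i
    simp only [q]
    split_ifs with hi
    · simpa using hac
    · have := abs_lt.1 (hJ i hi)
      exact hin _ ⟨this.1.le, this.2.le⟩
  -- The multiple `f 0` of the identity is the same in both bases and cancels. Since `g` is diagonal
  -- in a single basis, the cost `A ε` is paid once and not per eigenvalue.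
  have e1 : (fun i => f (l i)) = g + (gJ + (r + fun _ => f 0)) := by
    funext i
    simp only [g, κ, gJ, r, Pi.add_apply]
    split_ifs <;> ring
  have e2 : (fun i => f (m i)) = gJ + (q + fun _ => f 0) := by
    funext i
    simp only [gJ, q, Pi.add_apply]
    split_ifs <;> ring
  have e3 : ‖diagonalOp v gJ x - diagonalOp w gJ x‖ ≤ 2 * J.card * s * ‖x‖ := by
    have : diagonalOp v gJ x - diagonalOp w gJ x = ∑ i ∈ J, (f (m i) - f 0) •
        ((inner ℝ (v i) x : ℝ) • v i - (inner ℝ (w i) x : ℝ) • w i) := by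
      rw [diagonalOp, diagonalOp, ← Finset.sum_sub_distrib, ← Finset.sum_subset J.subset_univ]
      · refine Finset.sum_congr rfl fun i hi => ?_
        simp only [gJ, if_pos hi, mul_smul, smul_sub]
      · intro i _ hi
        simp [gJ, hi]
    rw [this]
    refine (norm_sum_le _ _).trans ((Finset.sum_le_card_nsmul _ _ (2 * (s * ‖x‖)) ?_).trans_eq ?_)
    · intro i hi
      rw [norm_smul]
      refine mul_le_mul ?_ (norm_projection_sub_le (v.norm_eq_one i) (w.norm_eq_one i) hs
        (hvw i hi) x) (norm_nonneg _) (by norm_num)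
      have := abs_sub (f (m i)) (f 0)
      rw [Real.norm_eq_abs]
      linarith [hf _ (hm1 i), hf 0 h0]
    · rw [nsmul_eq_mul]
      ring
  rw [e1, e2, diagonalOp_add, diagonalOp_add, diagonalOp_add, diagonalOp_add, diagonalOp_add,
    diagonalOp_const, diagonalOp_const]
  calc _ = ‖diagonalOp v g x + (diagonalOp v gJ x - diagonalOp w gJ x) + diagonalOp v r x -
        diagonalOp w q x‖ := by congr 1; abel
    _ ≤ ‖diagonalOp v g x‖ + ‖diagonalOp v gJ x - diagonalOp w gJ x‖ + ‖diagonalOp v r x‖ +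
        ‖diagonalOp w q x‖ := (norm_sub_le _ _).trans (by gcongr; exact norm_add₃_le)
    _ ≤ A * ε * ‖x‖ + 2 * J.card * s * ‖x‖ + a * c * ‖x‖ + a * c * ‖x‖ := by
        gcongr
        · exact norm_diagonalOp_le v (by positivity) hg x
        · exact norm_diagonalOp_le v hac hr x
        · exact norm_diagonalOp_le w hac hq x
    _ = _ := by ring

end Spectral

/-! ### Eigenvalues of operators which factor through a finite-dimensional space -/

section PosEigenvalue

/-- For a decreasing sequence the indices with value at least `t` form an initial segment. This
turns the dimension count in `posEigenvalue` into a condition on one entry. -/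
theorem le_card_filter_le_iff {n : ℕ} {l : Fin n → ℝ} (hl : Antitone l) (k : Fin n) (t : ℝ) :
    (k : ℕ) + 1 ≤ (Finset.univ.filter fun i => t ≤ l i).card ↔ t ≤ l k := by
  constructor
  · intro h
    by_contra! hlt
    have : (Finset.univ.filter fun i => t ≤ l i) ⊆ Finset.Iio k := by
      intro i hi
      rw [Finset.mem_filter] at hi
      rw [Finset.mem_Iio]
      by_contra! hki
      exact absurd (hi.2.trans (hl hki)) (not_le.2 hlt)
    have := Finset.card_le_card this
    rw [Fin.card_Iio] at this
    omega
  · intro h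
    have : Finset.Iic k ⊆ Finset.univ.filter fun i => t ≤ l i := by
      intro i hi
      rw [Finset.mem_Iic] at hi
      simpa using h.trans (hl hi)
    have := Finset.card_le_card this
    rwa [Fin.card_Iic] at this

variable {E F : Type} [AddCommGroup E] [Module ℝ E] [NormedAddCommGroup F] [InnerProductSpace ℝ F]
  {n : ℕ}

/-- An eigenvector for `s ≠ 0` is `s⁻¹` times its image under `T`, hence lies in the range of `ι`,
where `T` acts as `M`. Only the possibly infinite-dimensional kernel is lost, and `t > 0` excludes
it. -/
theorem rank_iSup_eigenspace {T : Module.End ℝ E} {M : F →ₗ[ℝ] F} {ι : F →ₗ[ℝ] E}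
    (hinj : Function.Injective ι) (hι : ∀ x, T (ι x) = ι (M x)) (hT : ∀ f, ∃ x, T f = ι x)
    {b : OrthonormalBasis (Fin n) ℝ F} {l : Fin n → ℝ} (hM : ∀ i, M (b i) = l i • b i)
    {t : ℝ} (ht : 0 < t) :
    Module.rank ℝ ↥(⨆ s ∈ Ici t, T.eigenspace s) =
      ((Finset.univ.filter fun i => t ≤ l i).card : ℕ) := by
  let S : Finset (Fin n) := Finset.univ.filter fun i => t ≤ l i
  let v : S → E := fun i => ι (b i)
  have hv : LinearIndependent ℝ v :=
    (b.orthonormal.linearIndependent.map' ι (LinearMap.ker_eq_bot.2 hinj)).comp _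
      Subtype.val_injective
  have key : (⨆ s ∈ Ici t, T.eigenspace s) = Submodule.span ℝ (range v) := by
    apply le_antisymm
    · refine iSup₂_le fun s hs f hf => ?_
      have hs0 : 0 < s := ht.trans_le hs
      rw [Module.End.mem_eigenspace_iff] at hf
      obtain ⟨x, hx⟩ := hT f
      have hfx : f = ι (s⁻¹ • x) := by
        rw [map_smul, ← hx, hf, smul_smul, inv_mul_cancel₀ hs0.ne', one_smul]
      set y := s⁻¹ • x
      have hy : M y = s • y := hinj (by rw [← hι, ← hfx, hf, map_smul, ← hfx])
      rw [hfx, ← b.sum_repr' y, map_sum]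
      refine Submodule.sum_mem _ fun i _ => ?_
      rw [map_smul]
      by_cases hi : t ≤ l i
      · exact Submodule.smul_mem _ _ (Submodule.subset_span ⟨⟨i, by simpa [S] using hi⟩, rfl⟩)
      · have h1 := inner_apply_of_eigenbasis hM y i
        rw [hy, inner_smul_right] at h1
        have h2 : (inner ℝ (b i) y : ℝ) = 0 := by
          by_contra hne
          exact hi (mul_right_cancel₀ hne h1 ▸ hs)
        rw [h2, zero_smul]
        exact Submodule.zero_mem _
    · rw [Submodule.span_le]
      rintro _ ⟨⟨i, hi⟩, rfl⟩
      have hi' : l i ∈ Ici t := by simpa [S] using hi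
      refine Submodule.mem_iSup_of_mem (l i) (Submodule.mem_iSup_of_mem hi' ?_)
      rw [Module.End.mem_eigenspace_iff]
      simp only [v]
      rw [hι, hM, map_smul]
  rw [key, rank_span hv, Cardinal.mk_range_eq _ hv.injective]
  simp [S, Fintype.card_subtype]

theorem posEigenvalue_add_one {T : Module.End ℝ E} {M : F →ₗ[ℝ] F} {ι : F →ₗ[ℝ] E}
    (hinj : Function.Injective ι) (hι : ∀ x, T (ι x) = ι (M x)) (hT : ∀ f, ∃ x, T f = ι x)
    {b : OrthonormalBasis (Fin n) ℝ F} {l : Fin n → ℝ} (hM : ∀ i, M (b i) = l i • b i)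
    (hl : Antitone l) (k : Fin n) : posEigenvalue T (k + 1) = max (l k) 0 := by
  refine IsGreatest.csSup_eq ⟨?_, ?_⟩
  · rcases le_or_gt (l k) 0 with h | h
    · exact Or.inl (max_eq_right h)
    · rw [max_eq_left h.le]
      refine Or.inr ⟨h, ?_⟩
      rw [rank_iSup_eigenspace hinj hι hT hM h]
      exact Nat.cast_le.2 ((le_card_filter_le_iff hl k _).2 le_rfl)
  · rintro t (rfl | ⟨ht, hk⟩)
    · exact le_max_right _ _
    · rw [rank_iSup_eigenspace hinj hι hT hM ht, Nat.cast_le, le_card_filter_le_iff hl] at hk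
      exact hk.trans (le_max_left _ _)

theorem posEigenvalue_eq_zero_of_lt {T : Module.End ℝ E} {M : F →ₗ[ℝ] F} {ι : F →ₗ[ℝ] E}
    (hinj : Function.Injective ι) (hι : ∀ x, T (ι x) = ι (M x)) (hT : ∀ f, ∃ x, T f = ι x)
    {b : OrthonormalBasis (Fin n) ℝ F} {l : Fin n → ℝ} (hM : ∀ i, M (b i) = l i • b i)
    {k : ℕ} (hk : n < k) : posEigenvalue T k = 0 := by
  refine IsGreatest.csSup_eq ⟨Or.inl rfl, ?_⟩
  rintro t (rfl | ⟨ht, h⟩)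
  · exact le_rfl
  · rw [rank_iSup_eigenspace hinj hι hT hM ht, Nat.cast_le] at h
    have := (Finset.univ.filter fun i => t ≤ l i).card_le_univ
    rw [Fintype.card_fin] at this
    omega

end PosEigenvalue

/-! ### Step functions and the shift operator of an induced graphon -/

theorem volume_cell {n : ℕ} (i : Fin n) : volume (cell n i) = ENNReal.ofReal (n : ℝ)⁻¹ := by
  have hn : (0 : ℝ) < n := by exact_mod_cast (Nat.zero_le _).trans_lt i.2
  have hi : ((i : ℝ) + 1) / n ≤ 1 := by
    rw [div_le_one hn]
    exact_mod_cast i.2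
  have hi0 : (0 : ℝ) ≤ (i : ℝ) / n := by positivity
  have hlen : ((i : ℝ) + 1) / n - (i : ℝ) / n = (n : ℝ)⁻¹ := by field_simp; ring
  have himg : volume (cell n i) = volume (((↑) : I → ℝ) '' cell n i) :=
    (((MeasurableEmbedding.subtype_coe measurableSet_Icc).comap_apply _ _))
  rw [himg]
  -- The cell lies between the half-open and the closed interval with the same endpoints, which also
  -- covers the last cell, closed at `1`.
  apply le_antisymm
  · rw [← hlen, ← Real.volume_Icc]
    refine measure_mono ?_
    rintro _ ⟨t, ⟨h1, h2⟩, rfl⟩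
    refine ⟨h1, ?_⟩
    rcases h2 with h2 | h2
    · exact h2.le
    · have : ((i : ℝ) + 1) / n = 1 := by
        rw [div_eq_one_iff_eq hn.ne']
        exact_mod_cast h2
      rw [this]
      exact t.2.2
  · rw [← hlen, ← Real.volume_Ico]
    refine measure_mono fun t ht => ?_
    exact ⟨⟨t, hi0.trans ht.1, ht.2.le.trans hi⟩, ⟨ht.1, Or.inl ht.2⟩, rfl⟩

theorem indicator_cell_mul (n : ℕ) (i j : Fin n) (t : I) :
    (cell n i).indicator (fun _ => (1 : ℝ)) t * (cell n j).indicator (fun _ => (1 : ℝ)) t =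
      if i = j then (cell n i).indicator (fun _ => (1 : ℝ)) t else 0 := by
  classical
  split_ifs with h
  · subst h
    by_cases ht : t ∈ cell n i <;> simp [ht]
  · by_cases hi : t ∈ cell n i
    · by_cases hj : t ∈ cell n j
      · rcases lt_or_gt_of_ne h with h | h
        · exact (cell_disjoint h hi hj).elim
        · exact (cell_disjoint h hj hi).elim
      · simp [hj]
    · simp [hi]

theorem memLp_step {n : ℕ} (x : Fin n → ℝ) :
    MemLp (fun t => ∑ i, x i * (cell n i).indicator (fun _ => (1 : ℝ)) t) 2
      (volume : Measure I) :=
  memLp_finsetSum _ fun i _ =>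
    (memLp_indicator_const 2 (measurableSet_cell n i) (1 : ℝ)
      (Or.inr (measure_ne_top _ _))).const_mul (x i)

/-- The step function on the regular partition with given values, as an element of `L²`. -/
def stepMap (n : ℕ) : EuclideanSpace ℝ (Fin n) →ₗ[ℝ] L2I where
  toFun x := (memLp_step x.ofLp).toLp _
  map_add' x y := by
    rw [← MemLp.toLp_add]
    refine MemLp.toLp_congr _ _ (Filter.Eventually.of_forall fun t => ?_)
    simp [add_mul, Finset.sum_add_distrib]
  map_smul' r x := by
    rw [RingHom.id_apply, ← MemLp.toLp_const_smul]
    refine MemLp.toLp_congr _ _ (Filter.Eventually.of_forall fun t => ?_)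
    simp [mul_assoc, Finset.mul_sum]

theorem stepMap_ae {n : ℕ} (x : EuclideanSpace ℝ (Fin n)) :
    (stepMap n x : I → ℝ) =ᵐ[volume]
      fun t => ∑ i, x i * (cell n i).indicator (fun _ => (1 : ℝ)) t :=
  (memLp_step x.ofLp).coeFn_toLp

theorem integral_indicator_mul_stepMap {n : ℕ} (x : EuclideanSpace ℝ (Fin n)) (i : Fin n) :
    ∫ u, (cell n i).indicator (fun _ => (1 : ℝ)) u * stepMap n x u = (n : ℝ)⁻¹ * x i := by
  have : (fun u => (cell n i).indicator (fun _ => (1 : ℝ)) u * stepMap n x u) =ᵐ[volume]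
      (cell n i).indicator fun _ => x i := by
    filter_upwards [stepMap_ae x] with u hu
    rw [hu, Finset.mul_sum, Finset.sum_eq_single i]
    · rw [mul_left_comm, indicator_cell_mul, if_pos rfl]
      by_cases hu : u ∈ cell n i <;> simp [hu]
    · intro j _ hj
      rw [mul_left_comm, indicator_cell_mul, if_neg hj.symm, mul_zero]
    · simp
  rw [integral_congr_ae this, integral_indicator_const _ (measurableSet_cell n i), measureReal_def,
    volume_cell, ENNReal.toReal_ofReal (by positivity), smul_eq_mul]

theorem stepMap_injective (n : ℕ) : Function.Injective (stepMap n) := by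
  intro x y h
  ext i
  have hn : ((n : ℝ)⁻¹) ≠ 0 := by
    have : 0 < n := (Nat.zero_le _).trans_lt i.2
    positivity
  have h1 := integral_indicator_mul_stepMap x i
  rw [h, integral_indicator_mul_stepMap y i] at h1
  exact (mul_left_cancel₀ hn h1).symm

theorem integrable_indicator_cell_mul {n : ℕ} (f : L2I) (i : Fin n) :
    Integrable (fun u => (cell n i).indicator (fun _ => (1 : ℝ)) u * f u) := by
  have hf : Integrable (f : I → ℝ) := (Lp.memLp f).integrable (by norm_num)
  refine hf.bdd_mul (c := 1)
    ((measurable_const.indicator (measurableSet_cell n i)).aestronglyMeasurable)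
    (Filter.Eventually.of_forall fun u => ?_)
  by_cases hu : u ∈ cell n i <;> simp [hu]

namespace NodeGraph

variable {n : ℕ} (G : NodeGraph n)

theorem shift_inducedGraphon (f : L2I) :
    G.inducedGraphon.shift f = stepMap n (WithLp.toLp 2 fun j => ∑ i, G.adj i j *
      ∫ u, (cell n i).indicator (fun _ => (1 : ℝ)) u * f u) := by
  refine MemLp.toLp_congr (G.inducedGraphon.memLp_shift f) (memLp_step _)
    (Filter.Eventually.of_forall fun v => ?_)
  simp only [inducedGraphon, Finset.sum_mul]
  have hint : ∀ i j : Fin n, Integrable (fun u => G.adj i j *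
      (cell n i).indicator (fun _ => (1 : ℝ)) u *
      (cell n j).indicator (fun _ => (1 : ℝ)) v * f u) := by
    intro i j
    refine ((integrable_indicator_cell_mul f i).const_mul
      (G.adj i j * (cell n j).indicator (fun _ => (1 : ℝ)) v)).congr
      (Filter.Eventually.of_forall fun u => ?_)
    simp only
    ring
  rw [integral_finsetSum _ fun i _ => integrable_finsetSum _ fun j _ => hint i j]
  refine (Finset.sum_congr rfl fun i _ => integral_finsetSum _ fun j _ => hint i j).trans ?_
  rw [Finset.sum_comm]
  refine Finset.sum_congr rfl fun j _ => Finset.sum_congr rfl fun i _ => ?_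
  rw [mul_right_comm, ← integral_const_mul]
  congr 1
  funext u
  ring

/-- The shift operator of the graph, normalized by the number of nodes. -/
def normalizedShift : EuclideanSpace ℝ (Fin n) →ₗ[ℝ] EuclideanSpace ℝ (Fin n) :=
  Matrix.toEuclideanLin ((n : ℝ)⁻¹ • G.adj)

/-- The factor `1/n` is the length of a cell. Symmetry enters because the shift integrates over the
first argument while `mulVec` sums over the second. -/
theorem shift_inducedGraphon_stepMap (x : EuclideanSpace ℝ (Fin n)) :
    G.inducedGraphon.shift (stepMap n x) = stepMap n (G.normalizedShift x) := by
  rw [shift_inducedGraphon]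
  congr 1
  ext j
  simp only [integral_indicator_mul_stepMap, normalizedShift, Matrix.toLpLin_apply,
    Matrix.mulVec, dotProduct, Matrix.smul_apply, smul_eq_mul]
  refine Finset.sum_congr rfl fun i _ => ?_
  rw [G.symm' i j]
  ring

theorem normalizedShift_isSymmetric : G.normalizedShift.IsSymmetric := by
  refine Matrix.isSymmetric_toEuclideanLin_iff.2 ?_
  ext i j
  simp [G.symm' i j]

/-- An orthonormal eigenbasis of the normalized shift operator, with decreasing eigenvalues. -/
theorem exists_eigenbasis : ∃ (b : OrthonormalBasis (Fin n) ℝ (EuclideanSpace ℝ (Fin n)))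
    (l : Fin n → ℝ), Antitone l ∧ ∀ i, G.normalizedShift (b i) = l i • b i :=
  ⟨G.normalizedShift_isSymmetric.eigenvectorBasis finrank_euclideanSpace_fin,
    G.normalizedShift_isSymmetric.eigenvalues finrank_euclideanSpace_fin,
    G.normalizedShift_isSymmetric.eigenvalues_antitone _,
    G.normalizedShift_isSymmetric.apply_eigenvectorBasis _⟩

variable {b : OrthonormalBasis (Fin n) ℝ (EuclideanSpace ℝ (Fin n))} {l : Fin n → ℝ}

theorem eigenvalue_pos_index (hl : Antitone l) (hb : ∀ i, G.normalizedShift (b i) = l i • b i)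
    (k : Fin n) : G.inducedGraphon.eigenvalue ((k : ℤ) + 1) = max (l k) 0 := by
  have : ((k : ℤ) + 1).natAbs = k + 1 := by omega
  rw [Graphon.eigenvalue, if_pos (by omega), this]
  exact posEigenvalue_add_one (stepMap_injective n) G.shift_inducedGraphon_stepMap
    (fun f => ⟨_, G.shift_inducedGraphon f⟩) hb hl k

/-- Negation reverses the order: the decreasing eigenvalues of the negated shift are `-l i.rev`, so
position `k` from the top is position `k.rev + 1` from the bottom. -/
theorem eigenvalue_neg_index (hl : Antitone l) (hb : ∀ i, G.normalizedShift (b i) = l i • b i)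
    (k : Fin n) : G.inducedGraphon.eigenvalue (-((k.rev : ℤ) + 1)) = min (l k) 0 := by
  have : (-((k.rev : ℤ) + 1)).natAbs = k.rev + 1 := by omega
  rw [Graphon.eigenvalue, if_neg (by omega), this,
    posEigenvalue_add_one (M := -G.normalizedShift) (b := b.reindex Fin.revPerm)
      (l := fun i => -l i.rev) (stepMap_injective n)]
  · have : max (-l k) 0 = -min (l k) 0 := by simpa using max_neg_neg (l k) 0
    rw [Fin.rev_rev, this, neg_neg]
  · intro x
    simp [G.shift_inducedGraphon_stepMap]
  · intro f
    obtain ⟨x, hx⟩ : ∃ x, G.inducedGraphon.shift f = stepMap n x := ⟨_, G.shift_inducedGraphon f⟩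
    exact ⟨-x, by rw [LinearMap.neg_apply, hx, map_neg]⟩
  · intro i
    simp [hb]
  · intro i j hij
    exact neg_le_neg (hl (Fin.rev_le_rev.2 hij))

/-- A padding zero, used as the index of every vanishing entry of `l`. -/
theorem eigenvalue_add_one (hb : ∀ i, G.normalizedShift (b i) = l i • b i) :
    G.inducedGraphon.eigenvalue ((n : ℤ) + 1) = 0 := by
  rw [Graphon.eigenvalue, if_pos (by omega)]
  exact posEigenvalue_eq_zero_of_lt (stepMap_injective n) G.shift_inducedGraphon_stepMap
    (fun f => ⟨_, G.shift_inducedGraphon f⟩) hb (by omega)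

end NodeGraph

/-! ### Matching ordered matrix eigenvalues with signed indices -/

/-- The index in `ℤ \ {0}`, ordered by sign and magnitude, of the `k`-th entry of a decreasing
sequence of eigenvalues. -/
def signedIndex {n : ℕ} (l : Fin n → ℝ) (k : Fin n) : ℤ :=
  if 0 < l k then (k : ℤ) + 1 else if l k < 0 then -((k.rev : ℤ) + 1) else (n : ℤ) + 1

theorem signedIndex_ne_zero {n : ℕ} (l : Fin n → ℝ) (k : Fin n) : signedIndex l k ≠ 0 := by
  rw [signedIndex]
  split_ifs <;> omega

/-- Distinct positions can collide only at the shared index `n + 1` of zero eigenvalues, which `m k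
≠ 0` rules out. Hence distinct positions satisfy the constraint `j ≠ i` of the margin. -/
theorem signedIndex_ne {n : ℕ} (l m : Fin n → ℝ) {j k : Fin n} (hjk : j ≠ k) (hk : m k ≠ 0) :
    signedIndex l j ≠ signedIndex m k := by
  have := j.2
  have := k.2
  have hjk' : (j : ℕ) ≠ k := fun h => hjk (Fin.ext h)
  rw [signedIndex, signedIndex]
  simp only [Fin.val_rev]
  rcases lt_or_gt_of_ne hk with h | h
  · rw [if_neg (not_lt.2 h.le), if_pos h]
    split_ifs <;> omega
  · rw [if_pos h]
    split_ifs <;> omega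

theorem NodeGraph.eigenvalue_signedIndex {n : ℕ} (G : NodeGraph n)
    {b : OrthonormalBasis (Fin n) ℝ (EuclideanSpace ℝ (Fin n))} {l : Fin n → ℝ}
    (hl : Antitone l) (hb : ∀ i, G.normalizedShift (b i) = l i • b i) (k : Fin n) :
    G.inducedGraphon.eigenvalue (signedIndex l k) = l k := by
  rw [signedIndex]
  split_ifs with h1 h2
  · rw [G.eigenvalue_pos_index hl hb, max_eq_left h1.le]
  · rw [G.eigenvalue_neg_index hl hb, min_eq_left h2.le]
  · rw [G.eigenvalue_add_one hb]
    exact (le_antisymm (not_lt.1 h1) (not_lt.1 h2)).symm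

theorem NodeGraph.card_le_bandCard {n : ℕ} (G : NodeGraph n)
    {b : OrthonormalBasis (Fin n) ℝ (EuclideanSpace ℝ (Fin n))} {l : Fin n → ℝ}
    (hl : Antitone l) (hb : ∀ i, G.normalizedShift (b i) = l i • b i) {c : ℝ} (hc : 0 < c) :
    ((Finset.univ.filter fun i => c ≤ |l i|).card : ℕ∞) ≤ G.inducedGraphon.bandCard c := by
  rw [← Set.encard_coe_eq_coe_finsetCard, ← InjOn.encard_image (f := signedIndex l)]
  · refine encard_le_encard ?_
    rintro _ ⟨k, hk, rfl⟩
    refine ⟨signedIndex_ne_zero l k, ?_⟩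
    rw [G.eigenvalue_signedIndex hl hb]
    simpa using hk
  · intro j _ k hk h
    by_contra hjk
    have hk' : c ≤ |l k| := by simpa using hk
    exact signedIndex_ne l l hjk (abs_pos.1 (hc.trans_le hk')) h

theorem NodeGraph.eigenvalueMargin_le {n : ℕ} (G G' : NodeGraph n)
    {v w : OrthonormalBasis (Fin n) ℝ (EuclideanSpace ℝ (Fin n))} {l m : Fin n → ℝ}
    (hl : Antitone l) (hv : ∀ i, G.normalizedShift (v i) = l i • v i)
    (hm : Antitone m) (hw : ∀ i, G'.normalizedShift (w i) = m i • w i) {c : ℝ} (hc : 0 < c)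
    {j k : Fin n} (hjk : j ≠ k) (hk : c ≤ |m k|) :
    G.inducedGraphon.eigenvalueMargin G'.inducedGraphon c ≤ ENNReal.ofReal |m k - l j| := by
  rw [← G.eigenvalue_signedIndex hl hv j, ← G'.eigenvalue_signedIndex hm hw k]
  refine (iInf₂_le (signedIndex m k) (signedIndex l j)).trans (iInf_le _ ?_)
  refine ⟨signedIndex_ne_zero m k, signedIndex_ne_zero l j,
    signedIndex_ne l m hjk (abs_pos.1 (hc.trans_le hk)), ?_⟩
  rwa [G'.eigenvalue_signedIndex hm hw]

/-- The padding index `n + 1` always differs from that of `k`, even when `n = 1`, so the infimum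
contains a finite distance. -/
theorem NodeGraph.eigenvalueMargin_ne_top {n : ℕ} (G G' : NodeGraph n)
    {w : OrthonormalBasis (Fin n) ℝ (EuclideanSpace ℝ (Fin n))} {m : Fin n → ℝ}
    (hm : Antitone m) (hw : ∀ i, G'.normalizedShift (w i) = m i • w i) {c : ℝ} (hc : 0 < c)
    {k : Fin n} (hk : c ≤ |m k|) :
    G.inducedGraphon.eigenvalueMargin G'.inducedGraphon c ≠ ⊤ := by
  have hk0 : m k ≠ 0 := abs_pos.1 (hc.trans_le hk)
  refine ((((iInf₂_le (signedIndex m k) ((n : ℤ) + 1)).trans (iInf_le _ ?_)).trans_lt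
    ENNReal.ofReal_lt_top)).ne
  refine ⟨signedIndex_ne_zero m k, by omega, ?_, ?_⟩
  · have := k.2
    rw [signedIndex]
    split_ifs with h1 h2
    · omega
    · omega
    · exact absurd (le_antisymm (not_lt.1 h1) (not_lt.1 h2)) hk0
  · rwa [G'.eigenvalue_signedIndex hm hw]

/-! ### Graph filters in the eigenbasis -/

theorem graphFilter_eq_diagonalOp {K n : ℕ} (h : Fin K → ℝ) (G : NodeGraph n)
    {b : OrthonormalBasis (Fin n) ℝ (EuclideanSpace ℝ (Fin n))} {l : Fin n → ℝ}
    (hb : ∀ i, G.normalizedShift (b i) = l i • b i) (x : EuclideanSpace ℝ (Fin n)) :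
    graphFilter h G x = diagonalOp b (fun i => spectralResponse h (l i)) x := by
  let F : EuclideanSpace ℝ (Fin n) →ₗ[ℝ] EuclideanSpace ℝ (Fin n) :=
    ∑ k, h k • G.normalizedShift ^ (k : ℕ)
  have hpow : ∀ (k : ℕ) (y : EuclideanSpace ℝ (Fin n)), (G.normalizedShift ^ k) y =
      WithLp.toLp 2 ((((n : ℝ)⁻¹ • G.adj) ^ k).mulVec y.ofLp) := by
    intro k
    induction k with
    | zero => intro y; simp
    | succ k ih =>
      intro y
      rw [pow_succ', Module.End.mul_apply, ih, pow_succ', ← Matrix.mulVec_mulVec]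
      rfl
  have hF : graphFilter h G x = F x := by
    simp only [graphFilter, F, LinearMap.sum_apply, LinearMap.smul_apply, hpow]
    rw [WithLp.toLp_sum]
    rfl
  have hpowb : ∀ (k : ℕ) i, (G.normalizedShift ^ k) (b i) = l i ^ k • b i := by
    intro k i
    induction k with
    | zero => simp
    | succ k ih => rw [pow_succ', Module.End.mul_apply, ih, map_smul, hb, smul_smul, pow_succ]
  rw [hF]
  refine apply_eq_diagonalOp (fun i => ?_) x
  simp only [F, LinearMap.sum_apply, LinearMap.smul_apply, hpowb, spectralResponse,
    Finset.sum_smul, smul_smul]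

/-- A matrix with entries of modulus at most `1` has operator norm at most `n`. -/
theorem norm_toEuclideanLin_le_card_mul {n : ℕ} {N : Matrix (Fin n) (Fin n) ℝ}
    (hN : ∀ i j, |N i j| ≤ 1) (x : EuclideanSpace ℝ (Fin n)) :
    ‖Matrix.toEuclideanLin N x‖ ≤ n * ‖x‖ := by
  refine le_of_sq_le_sq ?_ (by positivity)
  rw [EuclideanSpace.norm_sq_eq, mul_pow]
  calc _ ≤ ∑ i : Fin n, (n : ℝ) * ‖x‖ ^ 2 := by
        refine Finset.sum_le_sum fun i _ => ?_
        rw [Matrix.toLpLin_apply, Real.norm_eq_abs, sq_abs]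
        simp only [Matrix.mulVec, dotProduct]
        refine (Finset.sum_mul_sq_le_sq_mul_sq _ _ _).trans ?_
        rw [EuclideanSpace.norm_sq_eq]
        simp only [Real.norm_eq_abs, sq_abs]
        refine mul_le_mul_of_nonneg_right ?_ (Finset.sum_nonneg fun _ _ => sq_nonneg _)
        refine (Finset.sum_le_card_nsmul _ _ 1 fun j _ => ?_).trans_eq (by simp)
        rw [← sq_abs]
        exact pow_le_one₀ (abs_nonneg _) (hN i j)
    _ = (n : ℝ) ^ 2 * ‖x‖ ^ 2 := by simp; ring

theorem NodeGraph.norm_normalizedShift_le {n : ℕ} (G : NodeGraph n)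
    (x : EuclideanSpace ℝ (Fin n)) : ‖G.normalizedShift x‖ ≤ ‖x‖ := by
  rcases Nat.eq_zero_or_pos n with rfl | hn
  · simp [Subsingleton.elim (G.normalizedShift x) 0]
  have hn' : (0 : ℝ) < n := by exact_mod_cast hn
  rw [normalizedShift, map_smul, LinearMap.smul_apply, norm_smul, Real.norm_eq_abs,
    abs_of_pos (inv_pos.2 hn')]
  have := norm_toEuclideanLin_le_card_mul (N := G.adj) (fun i j => by
    rw [abs_of_nonneg (G.mem' i j).1]; exact (G.mem' i j).2) x
  rw [inv_mul_le_iff₀ hn']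
  exact this

theorem NodeGraph.eigenvalue_mem_Icc {n : ℕ} (G : NodeGraph n)
    {b : OrthonormalBasis (Fin n) ℝ (EuclideanSpace ℝ (Fin n))} {l : Fin n → ℝ}
    (hb : ∀ i, G.normalizedShift (b i) = l i • b i) (i : Fin n) : l i ∈ Icc (-1 : ℝ) 1 := by
  have := G.norm_normalizedShift_le (b i)
  rw [hb, norm_smul, b.norm_eq_one, mul_one, Real.norm_eq_abs] at this
  exact abs_le.1 this

/-! ### Concentration of random symmetric matrices with Bernoulli entries -/

section Bernoulli

/-- Hoeffding's lemma for the two-point law: the centered variable ranges over an interval of length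
`1`, so its variance proxy is `1/4`. -/
theorem bernoulli_mgf_le {w : ℝ} (hw : w ∈ Icc (0 : ℝ) 1) (b : ℝ) :
    w * Real.exp (b * (1 - w)) + (1 - w) * Real.exp (b * (0 - w)) ≤ Real.exp (b ^ 2 / 8) := by
  let μ : Measure ℝ := ENNReal.ofReal w • Measure.dirac 1 + ENNReal.ofReal (1 - w) • Measure.dirac 0
  have h1 : 0 ≤ 1 - w := by linarith [hw.2]
  have hint : ∀ g : ℝ → ℝ, ∫ x, g x ∂μ = w * g 1 + (1 - w) * g 0 := by
    intro g
    rw [integral_add_measure ((integrable_dirac (by simp)).smul_measure ENNReal.ofReal_ne_top)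
      ((integrable_dirac (by simp)).smul_measure ENNReal.ofReal_ne_top), integral_smul_measure,
      integral_smul_measure, integral_dirac, integral_dirac, ENNReal.toReal_ofReal hw.1,
      ENNReal.toReal_ofReal h1, smul_eq_mul, smul_eq_mul]
  have : IsProbabilityMeasure μ := by
    constructor
    simp only [μ, Measure.add_apply, Measure.smul_apply, measure_univ, smul_eq_mul, mul_one]
    rw [← ENNReal.ofReal_add hw.1 h1]
    simp
  have hb : ∀ᵐ x ∂μ, x - w ∈ Icc (0 - w) (1 - w) := by
    have hm : MeasurableSet {x : ℝ | x - w ∈ Icc (0 - w) (1 - w)} :=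
      (measurable_id.sub_const w) measurableSet_Icc
    rw [ae_add_measure_iff]
    constructor <;> refine Measure.ae_smul_measure ?_ _ <;> rw [ae_dirac_iff hm] <;> constructor <;> simp
  have := (hasSubgaussianMGF_of_mem_Icc_of_integral_eq_zero (μ := μ) (X := fun x => x - w)
    (by fun_prop) hb (by rw [hint]; ring)).mgf_le b
  rw [mgf, hint] at this
  refine this.trans_eq ?_
  congr 1
  simp
  ring

variable {ι : Type*} [Fintype ι]

/-- The probability of the outcome `f` for independent Bernoulli variables of parameters `w`. -/
def bernoulliWeight (w : ι → ℝ) (f : ι → Bool) : ℝ := ∏ p, if f p then w p else 1 - w p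

theorem bernoulliWeight_nonneg {w : ι → ℝ} (hw : ∀ p, w p ∈ Icc (0 : ℝ) 1) (f : ι → Bool) :
    0 ≤ bernoulliWeight w f := by
  refine Finset.prod_nonneg fun p _ => ?_
  split_ifs
  · exact (hw p).1
  · linarith [(hw p).2]

/-- Independence: the sum over patterns of a product over entries factors, leaving one Hoeffding
bound per entry. -/
theorem sum_bernoulliWeight_mul_exp_le [DecidableEq ι] {w : ι → ℝ} (hw : ∀ p, w p ∈ Icc (0 : ℝ) 1) (b : ι → ℝ) :
    ∑ f, bernoulliWeight w f * Real.exp (∑ p, b p * ((if f p then 1 else 0) - w p)) ≤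
      Real.exp ((∑ p, b p ^ 2) / 8) := by
  have h1 : ∀ f : ι → Bool, bernoulliWeight w f *
      Real.exp (∑ p, b p * ((if f p then 1 else 0) - w p)) =
      ∏ p, (if f p then w p else 1 - w p) * Real.exp (b p * ((if f p then 1 else 0) - w p)) := by
    intro f
    rw [Real.exp_sum, bernoulliWeight, Finset.prod_mul_distrib]
  have h2 := Finset.prod_univ_sum (fun _ : ι => (Finset.univ : Finset Bool)) (fun p β =>
    (if β then w p else 1 - w p) * Real.exp (b p * ((if β then 1 else 0) - w p)))
  rw [Fintype.piFinset_univ] at h2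
  rw [Finset.sum_congr rfl fun f _ => h1 f, ← h2, Finset.sum_div, Real.exp_sum]
  refine Finset.prod_le_prod (fun p _ => Finset.sum_nonneg fun β _ => ?_) fun p _ => ?_
  · refine mul_nonneg ?_ (Real.exp_pos _).le
    split_ifs
    · exact (hw p).1
    · linarith [(hw p).2]
  · simpa using bernoulli_mgf_le (hw p) (b p)

end Bernoulli

/-- Unordered pairs of nodes, as pairs in increasing order. -/
abbrev NodePair (n : ℕ) : Type := {p : Fin n × Fin n // p.1 ≤ p.2}

theorem sum_sum_eq_sum_nodePair {n : ℕ} {φ : Fin n → Fin n → ℝ} (hφ : ∀ i j, φ i j = φ j i) :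
    ∑ i, ∑ j, φ i j = ∑ p : NodePair n, (if p.1.1 = p.1.2 then 1 else 2) * φ p.1.1 p.1.2 := by
  have h1 : ∑ i, ∑ j, φ i j = ∑ i, ∑ j, if i ≤ j then (if i = j then 1 else 2) * φ i j else 0 := by
    have h2 : ∑ i, ∑ j, φ i j = ∑ i, ∑ j, (if i ≤ j then φ i j else 0) +
        ∑ i, ∑ j, (if j < i then φ i j else 0) := by
      simp only [← Finset.sum_add_distrib]
      refine Finset.sum_congr rfl fun i _ => Finset.sum_congr rfl fun j _ => ?_
      rcases le_or_gt i j with h | h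
      · simp [h, not_lt.2 h]
      · simp [h, not_le.2 h]
    rw [h2, Finset.sum_comm (f := fun i j => if j < i then φ i j else 0)]
    simp only [← Finset.sum_add_distrib]
    refine Finset.sum_congr rfl fun i _ => Finset.sum_congr rfl fun j _ => ?_
    rcases lt_trichotomy i j with h | h | h
    · simp [h, h.le, h.ne, hφ j i]
      ring
    · simp [h]
    · simp [not_le.2 h, h.not_gt]
  rw [h1, ← Finset.sum_product', Finset.univ_product_univ, ← Finset.sum_filter]
  exact Finset.sum_subtype _ (by simp) _

/-- The difference between the symmetric `0/1` matrix with upper triangle `f` and `w`. -/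
def centeredPattern {n : ℕ} (w : Matrix (Fin n) (Fin n) ℝ) (f : NodePair n → Bool) :
    Matrix (Fin n) (Fin n) ℝ :=
  fun i j => (if f ⟨(min i j, max i j), min_le_max⟩ then 1 else 0) - w i j

section CenteredPattern

variable {n : ℕ} {w : Matrix (Fin n) (Fin n) ℝ}

theorem centeredPattern_symm (hw : ∀ i j, w i j = w j i) (f : NodePair n → Bool) (i j : Fin n) :
    centeredPattern w f i j = centeredPattern w f j i := by
  simp only [centeredPattern, min_comm i j, max_comm i j, hw i j]

theorem abs_centeredPattern_le (hw : ∀ i j, w i j ∈ Icc (0 : ℝ) 1) (f : NodePair n → Bool)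
    (i j : Fin n) : |centeredPattern w f i j| ≤ 1 := by
  have := hw i j
  rw [centeredPattern, abs_le]
  split_ifs <;> constructor <;> linarith [this.1, this.2]

/-- Rewrites the form as a linear combination of the independent entries; each off-diagonal entry
occurs twice. -/
theorem inner_centeredPattern (hw : ∀ i j, w i j = w j i) (f : NodePair n → Bool)
    (x : EuclideanSpace ℝ (Fin n)) :
    inner ℝ x (Matrix.toEuclideanLin (centeredPattern w f) x) =
      ∑ p : NodePair n, ((if p.1.1 = p.1.2 then 1 else 2) * (x p.1.1 * x p.1.2)) *
        ((if f p then 1 else 0) - w p.1.1 p.1.2) := by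
  have h1 : inner ℝ x (Matrix.toEuclideanLin (centeredPattern w f) x) =
      ∑ i, ∑ j, centeredPattern w f i j * (x i * x j) := by
    simp only [PiLp.inner_apply, Matrix.toLpLin_apply, Matrix.mulVec, dotProduct, Real.inner_apply,
      Finset.mul_sum]
    refine Finset.sum_congr rfl fun i _ => Finset.sum_congr rfl fun j _ => by ring
  rw [h1, sum_sum_eq_sum_nodePair fun i j => by rw [centeredPattern_symm hw]; ring]
  refine Finset.sum_congr rfl fun p _ => ?_
  have hp : (⟨(min p.1.1 p.1.2, max p.1.1 p.1.2), min_le_max⟩ : NodePair n) = p := by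
    ext1
    simp [min_eq_left p.2, max_eq_right p.2]
  rw [centeredPattern, hp]
  ring

/-- An off-diagonal pair contributes `4 xᵢ² xⱼ²` here and `2 xᵢ² xⱼ²` to `‖x‖⁴`, whence the factor
`2`. -/
theorem sum_nodePair_sq_le (x : EuclideanSpace ℝ (Fin n)) :
    ∑ p : NodePair n, ((if p.1.1 = p.1.2 then 1 else 2) * (x p.1.1 * x p.1.2)) ^ 2 ≤
      2 * ‖x‖ ^ 4 := by
  have h1 : ‖x‖ ^ 4 = ∑ i, ∑ j, x i ^ 2 * x j ^ 2 := by
    rw [← Finset.sum_mul_sum, show ‖x‖ ^ 4 = ‖x‖ ^ 2 * ‖x‖ ^ 2 by ring, EuclideanSpace.norm_sq_eq]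
    simp
  rw [h1, sum_sum_eq_sum_nodePair fun i j => mul_comm _ _, Finset.mul_sum]
  refine Finset.sum_le_sum fun p _ => ?_
  have := mul_nonneg (sq_nonneg (x p.1.1)) (sq_nonneg (x p.1.2))
  split_ifs <;> nlinarith

theorem sum_bernoulliWeight_mul_exp_inner_le (hw : ∀ i j, w i j = w j i)
    (hw1 : ∀ i j, w i j ∈ Icc (0 : ℝ) 1) (x : EuclideanSpace ℝ (Fin n)) (θ : ℝ) :
    ∑ f, bernoulliWeight (fun p : NodePair n => w p.1.1 p.1.2) f *
      Real.exp (θ * inner ℝ x (Matrix.toEuclideanLin (centeredPattern w f) x)) ≤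
      Real.exp (θ ^ 2 * ‖x‖ ^ 4 / 4) := by
  have := sum_bernoulliWeight_mul_exp_le (w := fun p : NodePair n => w p.1.1 p.1.2)
    (fun p => hw1 _ _) (fun p => θ * ((if p.1.1 = p.1.2 then 1 else 2) * (x p.1.1 * x p.1.2)))
  simp only [inner_centeredPattern hw, Finset.mul_sum, ← mul_assoc] at this ⊢
  refine this.trans (Real.exp_le_exp.2 ?_)
  have h2 := sum_nodePair_sq_le x
  simp only [mul_assoc, mul_pow θ, ← Finset.mul_sum] at h2 ⊢
  nlinarith [mul_le_mul_of_nonneg_left h2 (sq_nonneg θ)]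

end CenteredPattern

/-! ### Operator norm tail by volume comparison -/

/-- The quadratic form of a symmetric operator is large on a ball around a top eigenvector. -/
theorem exists_ball_abs_inner_ge {E : Type*} [NormedAddCommGroup E] [InnerProductSpace ℝ E]
    [FiniteDimensional ℝ E] {T : E →ₗ[ℝ] E} (hT : T.IsSymmetric) {t : ℝ} (ht : 0 ≤ t)
    (h : ¬ ∀ x, ‖T x‖ ≤ t * ‖x‖) :
    ∃ v : E, ‖v‖ = 1 ∧ ∀ y ∈ Metric.ball v (1 / 8), 47 / 64 * t ≤ |inner ℝ y (T y)| := by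
  let b := hT.eigenvectorBasis rfl
  let l := hT.eigenvalues rfl
  have hb : ∀ i, T (b i) = l i • b i := hT.apply_eigenvectorBasis rfl
  obtain ⟨j, hj⟩ : ∃ j, t < |l j| := by
    by_contra! hl
    exact h fun x => by rw [apply_eq_diagonalOp hb]; exact norm_diagonalOp_le b ht hl x
  have : Nonempty (Fin (Module.finrank ℝ E)) := ⟨j⟩
  -- With `|l i|` maximal it is the operator norm, so perturbing by `e` with `‖e‖ < 1/8` loses at
  -- most the fractions `2 · 1/8` and `(1/8)²`; and `1 - 1/4 - 1/64 = 47/64`.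
  obtain ⟨i, hi⟩ := Finite.exists_max fun i => |l i|
  refine ⟨b i, b.norm_eq_one i, fun y hy => ?_⟩
  obtain ⟨e, rfl⟩ : ∃ e, y = b i + e := ⟨y - b i, by abel⟩
  have he : ‖e‖ < 1 / 8 := by simpa using hy
  have h1 : inner ℝ (b i + e) (T (b i + e)) =
      l i + 2 * l i * inner ℝ (b i) e + inner ℝ e (T e) := by
    have h2 : inner ℝ (b i) (T e) = l i * inner ℝ (b i) e := inner_apply_of_eigenbasis hb e i
    have h3 : inner ℝ (b i) (b i) = (1 : ℝ) := by
      rw [real_inner_self_eq_norm_sq, b.norm_eq_one, one_pow]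
    rw [map_add, inner_add_left, inner_add_right, inner_add_right, h2, hb, inner_smul_right,
      inner_smul_right, h3, real_inner_comm]
    ring
  have h2 : |2 * l i * inner ℝ (b i) e| ≤ |l i| * (1 / 4) := by
    have := abs_real_inner_le_norm (b i) e
    rw [b.norm_eq_one, one_mul] at this
    rw [abs_mul, abs_mul, abs_two]
    nlinarith [abs_nonneg (l i)]
  have h3 : |(inner ℝ e (T e) : ℝ)| ≤ |l i| * (1 / 64) := by
    calc |(inner ℝ e (T e) : ℝ)| ≤ ‖e‖ * ‖T e‖ := abs_real_inner_le_norm _ _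
      _ ≤ ‖e‖ * (|l i| * ‖e‖) := by
          gcongr
          rw [apply_eq_diagonalOp hb]
          exact norm_diagonalOp_le b (abs_nonneg _) hi e
      _ = |l i| * ‖e‖ ^ 2 := by ring
      _ ≤ |l i| * (1 / 8) ^ 2 := by gcongr
      _ = _ := by norm_num
  have h4 : |l i| ≤ |inner ℝ (b i + e) (T (b i + e))| + |2 * l i * inner ℝ (b i) e| +
      |(inner ℝ e (T e) : ℝ)| := by
    rw [h1]
    set p := 2 * l i * inner ℝ (b i) e
    set q : ℝ := inner ℝ e (T e)
    calc |l i| = |(l i + p + q) - p - q| := by congr 1; ring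
      _ ≤ |l i + p + q - p| + |q| := abs_sub _ _
      _ ≤ _ := by gcongr; exact abs_sub _ _
  have h5 : t < |l i| := hj.trans_le (hi j)
  linarith

/-- Two-sided exponential Markov inequality, pointwise: one of the two exponents is nonnegative. -/
theorem one_le_exp_neg_mul_add {s q θ : ℝ} (hθ : 0 ≤ θ) (h : s ≤ |q|) :
    1 ≤ Real.exp (-(θ * s)) * (Real.exp (θ * q) + Real.exp (-θ * q)) := by
  rw [mul_add, ← Real.exp_add, ← Real.exp_add]
  have := mul_le_mul_of_nonneg_left h hθ
  rcases abs_choice q with hq | hq <;> rw [hq] at this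
  · have : 1 ≤ Real.exp (-(θ * s) + θ * q) := Real.one_le_exp (by linarith)
    linarith [Real.exp_pos (-(θ * s) + -θ * q)]
  · have : 1 ≤ Real.exp (-(θ * s) + -θ * q) := Real.one_le_exp (by linarith)
    linarith [Real.exp_pos (-(θ * s) + θ * q)]

open Classical in
/-- Chernoff bound for the operator norm of a random symmetric matrix with independent centered
Bernoulli entries. The union over directions is bounded by comparing volumes of balls. -/
theorem sum_bernoulliWeight_filter_le_exp {n : ℕ} {w : Matrix (Fin n) (Fin n) ℝ}
    (hw : ∀ i j, w i j = w j i) (hw1 : ∀ i j, w i j ∈ Icc (0 : ℝ) 1) {t θ : ℝ} (ht : 0 ≤ t)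
    (hθ : 0 ≤ θ) :
    ∑ f with ¬ ∀ x, ‖Matrix.toEuclideanLin (centeredPattern w f) x‖ ≤ t * ‖x‖,
        ENNReal.ofReal (bernoulliWeight (fun p : NodePair n => w p.1.1 p.1.2) f) ≤
      ENNReal.ofReal (9 ^ n * (2 * Real.exp (θ ^ 2 * (9 / 8) ^ 4 / 4 - θ * (47 / 64 * t)))) := by
  let V := EuclideanSpace ℝ (Fin n)
  let p : (NodePair n → Bool) → ℝ := bernoulliWeight fun p : NodePair n => w p.1.1 p.1.2
  have hp : ∀ f, 0 ≤ p f := bernoulliWeight_nonneg fun _ => hw1 _ _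
  let q : (NodePair n → Bool) → V → ℝ := fun f x =>
    inner ℝ x (Matrix.toEuclideanLin (centeredPattern w f) x)
  have hq : ∀ f, Continuous (q f) := fun f =>
    continuous_id.inner (LinearMap.continuous_of_finiteDimensional _)
  let g : (NodePair n → Bool) → V → ℝ := fun f x =>
    Real.exp (-(θ * (47 / 64 * t))) * (Real.exp (θ * q f x) + Real.exp (-θ * q f x))
  have hg : ∀ f, Measurable (g f) := fun f =>
    (continuous_const.mul ((Real.continuous_exp.comp (continuous_const.mul (hq f))).add
      (Real.continuous_exp.comp (continuous_const.mul (hq f))))).measurable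
  have hg0 : ∀ f x, 0 ≤ g f x := fun f x => by positivity
  -- Radius `1 + 1/8`: it contains every ball of radius `1/8` around a unit vector.
  let B : Set V := Metric.ball 0 (9 / 8)
  let r : ℝ := 2 * Real.exp (θ ^ 2 * (9 / 8) ^ 4 / 4 - θ * (47 / 64 * t))
  have hbad : ∀ f, (¬ ∀ x, ‖Matrix.toEuclideanLin (centeredPattern w f) x‖ ≤ t * ‖x‖) →
      volume (Metric.ball (0 : V) (1 / 8)) ≤ ∫⁻ x in B, ENNReal.ofReal (g f x) := by
    intro f hf
    have hsymm : (Matrix.toEuclideanLin (centeredPattern w f)).IsSymmetric := by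
      refine Matrix.isSymmetric_toEuclideanLin_iff.2 ?_
      ext i j
      simp [centeredPattern_symm hw f i j]
    obtain ⟨v, hv, hball⟩ := exists_ball_abs_inner_ge hsymm ht hf
    rw [← Measure.addHaar_ball_center volume v, ← setLIntegral_one]
    have hsub : Metric.ball v (1 / 8) ⊆ B := by
      refine Metric.ball_subset_ball' ?_
      rw [dist_zero_right, hv]
      norm_num
    refine (setLIntegral_mono' measurableSet_ball fun x hx => ?_).trans
      (lintegral_mono_set hsub)
    rw [ENNReal.one_le_ofReal]
    exact one_le_exp_neg_mul_add hθ (hball x hx)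
  have hsum : ∀ x ∈ B, ∑ f, p f * g f x ≤ r := by
    intro x hx
    have hx' : ‖x‖ ≤ 9 / 8 := by simpa using (Metric.mem_ball.1 hx).le
    have h1 := sum_bernoulliWeight_mul_exp_inner_le hw hw1 x θ
    have h2 := sum_bernoulliWeight_mul_exp_inner_le hw hw1 x (-θ)
    rw [neg_sq] at h2
    have h3 : Real.exp (θ ^ 2 * ‖x‖ ^ 4 / 4) ≤ Real.exp (θ ^ 2 * (9 / 8) ^ 4 / 4) := by gcongr
    calc ∑ f, p f * g f x = Real.exp (-(θ * (47 / 64 * t))) *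
          (∑ f, p f * Real.exp (θ * q f x) + ∑ f, p f * Real.exp (-θ * q f x)) := by
          rw [← Finset.sum_add_distrib, Finset.mul_sum]
          exact Finset.sum_congr rfl fun f _ => by simp only [g]; ring
      _ ≤ Real.exp (-(θ * (47 / 64 * t))) * (Real.exp (θ ^ 2 * (9 / 8) ^ 4 / 4) +
          Real.exp (θ ^ 2 * (9 / 8) ^ 4 / 4)) := by
          gcongr
          · exact h1.trans h3
          · exact h2.trans h3
      _ = r := by
          simp only [r]
          rw [sub_eq_add_neg, Real.exp_add]
          ring
  have hvol : volume B = ENNReal.ofReal (9 ^ n) * volume (Metric.ball (0 : V) (1 / 8)) := by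
    have := Measure.addHaar_ball_mul_of_pos (volume : Measure V) 0 (r := 9) (by norm_num) (1 / 8)
    rw [finrank_euclideanSpace_fin] at this
    rw [← this]
    norm_num [B]
  have hpos : volume (Metric.ball (0 : V) (1 / 8)) ≠ 0 :=
    (Metric.measure_ball_pos _ _ (by norm_num)).ne'
  have hfin : volume (Metric.ball (0 : V) (1 / 8)) ≠ ⊤ := measure_ball_lt_top.ne
  refine (ENNReal.mul_le_mul_iff_left hpos hfin).1 ?_
  calc _ = ∑ f with ¬ ∀ x, ‖Matrix.toEuclideanLin (centeredPattern w f) x‖ ≤ t * ‖x‖,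
        ENNReal.ofReal (p f) * volume (Metric.ball (0 : V) (1 / 8)) := Finset.sum_mul ..
    _ ≤ ∑ f with ¬ ∀ x, ‖Matrix.toEuclideanLin (centeredPattern w f) x‖ ≤ t * ‖x‖,
        ENNReal.ofReal (p f) * ∫⁻ x in B, ENNReal.ofReal (g f x) := by
        refine Finset.sum_le_sum fun f hf => mul_le_mul_right (hbad f (Finset.mem_filter.1 hf).2) _
    _ ≤ ∑ f, ENNReal.ofReal (p f) * ∫⁻ x in B, ENNReal.ofReal (g f x) :=
        Finset.sum_le_sum_of_subset (Finset.filter_subset _ _)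
    _ = ∫⁻ x in B, ENNReal.ofReal (∑ f, p f * g f x) := by
        rw [← lintegral_congr fun x => (ENNReal.ofReal_sum_of_nonneg fun f _ =>
          mul_nonneg (hp f) (hg0 f x)).symm, lintegral_finsetSum _ fun f _ =>
          ((hg f).const_mul _).ennreal_ofReal]
        refine Finset.sum_congr rfl fun f _ => ?_
        rw [← lintegral_const_mul _ (hg f).ennreal_ofReal]
        exact lintegral_congr fun x => (ENNReal.ofReal_mul (hp f)).symm
    _ ≤ ∫⁻ _ in B, ENNReal.ofReal r :=
        setLIntegral_mono' measurableSet_ball fun x hx => ENNReal.ofReal_le_ofReal (hsum x hx)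
    _ = _ := by
        rw [setLIntegral_const, hvol, ← mul_assoc, ← ENNReal.ofReal_mul (by positivity), mul_comm r]

/-- The choice `θ = 9/10 t` is close to the minimizer of the exponent. With `t² = 4nL` the exponent
is about `-1.346 nL`, enough to beat both `9 ^ n` and `exp L`. -/
theorem nine_pow_mul_exp_le {n : ℕ} {χ L : ℝ} (hχ : 0 < χ) (hχ1 : χ < 1) (hn : 0 < n)
    (hL : L = Real.log (2 * n / χ)) (hnL : 4 * L < n) {t : ℝ} (ht : t ^ 2 = 4 * (n * L)) :
    9 ^ n * (2 * Real.exp ((9 / 10 * t) ^ 2 * (9 / 8) ^ 4 / 4 - (9 / 10 * t) * (47 / 64 * t))) ≤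
      χ := by
  have hn0 : (0 : ℝ) < n := by exact_mod_cast hn
  have hχL : χ = 2 * n * Real.exp (-L) := by
    rw [Real.exp_neg, hL, Real.exp_log (by positivity)]
    field_simp
  have hLn : Real.log (2 * n) ≤ L := by
    rw [hL]
    refine Real.log_le_log (by positivity) ?_
    rw [le_div_iff₀ hχ]
    nlinarith
  -- The hypothesis `4L < n` and `log (2n) ≤ L` force `(2n)⁴ < eⁿ`, which fails for `1 ≤ n ≤ 12`.
  have hn13 : 13 ≤ n := by
    by_contra! hlt
    have h1 : (2 * n : ℝ) ^ 4 < Real.exp 1 ^ n := by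
      rw [Real.exp_one_pow, ← Real.log_lt_iff_lt_exp (by positivity), Real.log_pow]
      push_cast
      linarith
    have h2 : Real.exp 1 ^ n ≤ 2.7182818286 ^ n :=
      pow_le_pow_left₀ (Real.exp_pos 1).le Real.exp_one_lt_d9.le n
    have h3 := h1.trans_le h2
    interval_cases n <;> norm_num at h3
  have hn13' : (13 : ℝ) ≤ n := by exact_mod_cast hn13
  have hL3 : 3 ≤ L := by
    refine le_trans ?_ hLn
    rw [Real.le_log_iff_exp_le (by positivity)]
    have h1 : Real.exp 3 = Real.exp 1 ^ 3 := by rw [← Real.exp_nat_mul]; norm_num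
    have h2 : Real.exp 1 ^ 3 ≤ 2.7182818286 ^ 3 :=
      pow_le_pow_left₀ (Real.exp_pos 1).le Real.exp_one_lt_d9.le 3
    rw [h1]
    norm_num at h2
    linarith
  have h9 : (9 : ℝ) ^ n ≤ Real.exp (5 / 2 * n) := by
    have h5 : (9 : ℝ) ≤ Real.exp (5 / 2) := by
      refine le_of_sq_le_sq ?_ (Real.exp_pos _).le
      have h1 : Real.exp (5 / 2) ^ 2 = Real.exp 1 ^ 5 := by
        rw [← Real.exp_nat_mul, ← Real.exp_nat_mul]; norm_num
      have h2 : (2.7182818283 : ℝ) ^ 5 ≤ Real.exp 1 ^ 5 :=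
        pow_le_pow_left₀ (by norm_num) Real.exp_one_gt_d9.le 5
      rw [h1]
      norm_num at h2 ⊢
      linarith
    rw [mul_comm, Real.exp_nat_mul]
    exact pow_le_pow_left₀ (by norm_num) h5 n
  have hexp : (9 / 10 * t) ^ 2 * (9 / 8) ^ 4 / 4 - (9 / 10 * t) * (47 / 64 * t) ≤
      -(133 / 100 * (n * L)) := by
    have : 0 ≤ n * L := by positivity
    have e : (9 / 10 * t) ^ 2 * (9 / 8) ^ 4 / 4 - (9 / 10 * t) * (47 / 64 * t) =
      t ^ 2 * ((9 / 10) ^ 2 * (9 / 8) ^ 4 / 4 - 9 / 10 * (47 / 64)) := by ring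
    rw [e, ht]
    norm_num
    linarith
  calc _ ≤ Real.exp (5 / 2 * n) * (2 * Real.exp (-(133 / 100 * (n * L)))) := by gcongr
    _ = 2 * Real.exp (5 / 2 * n - 133 / 100 * (n * L)) := by
        rw [sub_eq_add_neg, Real.exp_add]
        ring
    _ ≤ 2 * n * Real.exp (-L) := by
        -- Since `L ≥ 3`, the term `5/2 n` is at most `5/6 nL`; what remains of `1.33 nL` exceeds
        -- `L` because `n ≥ 13`.
        have h1 : 5 / 2 * n - 133 / 100 * (n * L) ≤ -L := by
          nlinarith [mul_le_mul_of_nonneg_left hL3 hn0.le,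
            mul_le_mul_of_nonneg_right hn13' (by linarith : (0 : ℝ) ≤ L)]
        have h2 := Real.exp_le_exp.2 h1
        nlinarith [Real.exp_pos (-L)]
    _ = χ := hχL.symm

open Classical in
/-- With probability at least `1 - χ`, the random symmetric matrix with independent Bernoulli entries
differs from its mean `w` by at most `2 √(n log(2n/χ))` in operator norm. -/
theorem sum_bernoulliWeight_filter_le {n : ℕ} (hn : 0 < n) {w : Matrix (Fin n) (Fin n) ℝ}
    (hw : ∀ i j, w i j = w j i) (hw1 : ∀ i j, w i j ∈ Icc (0 : ℝ) 1) {χ : ℝ}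
    (hχ : 0 < χ) (hχ1 : χ < 1) :
    ∑ f with ¬ ∀ x, ‖Matrix.toEuclideanLin (centeredPattern w f) x‖ ≤
        2 * √(n * Real.log (2 * n / χ)) * ‖x‖,
        ENNReal.ofReal (bernoulliWeight (fun p : NodePair n => w p.1.1 p.1.2) f) ≤
      ENNReal.ofReal χ := by
  have hn1 : (1 : ℝ) ≤ n := by exact_mod_cast hn
  have hL : 0 ≤ Real.log (2 * n / χ) := by
    refine Real.log_nonneg ?_
    rw [le_div_iff₀ hχ]
    linarith
  set L := Real.log (2 * n / χ) with hLdef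
  have ht : (2 * √(n * L)) ^ 2 = 4 * (n * L) := by
    rw [mul_pow, Real.sq_sqrt (by positivity)]
    norm_num
  -- If `n ≤ 4L`, the threshold `2 √(nL)` is at least `n`, the trivial bound on the operator norm,
  -- and no pattern is bad.
  rcases lt_or_ge (4 * L) n with h | h
  · refine (sum_bernoulliWeight_filter_le_exp hw hw1 (by positivity)
      (θ := 9 / 10 * (2 * √(n * L))) (by positivity)).trans (ENNReal.ofReal_le_ofReal ?_)
    exact nine_pow_mul_exp_le hχ hχ1 hn hLdef h ht
  · have hnt : (n : ℝ) ≤ 2 * √(n * L) := by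
      refine le_of_sq_le_sq ?_ (by positivity)
      rw [ht]
      nlinarith
    rw [Finset.sum_eq_zero]
    · exact zero_le
    · intro f hf
      refine absurd (fun x => ?_) (Finset.mem_filter.1 hf).2
      exact (norm_toEuclideanLin_le_card_mul (abs_centeredPattern_le hw1 f) x).trans
        (mul_le_mul_of_nonneg_right hnt (norm_nonneg _))

/-! ### The deterministic transfer bound -/

namespace FilterCondition

variable {f : ℝ → ℝ} {A a c : ℝ}

theorem inner_Icc (hf : FilterCondition f A a c) (hcont : Continuous f) (hc : 0 < c) :
    ∀ x ∈ Icc (-c) c, ∀ y ∈ Icc (-c) c, |f x - f y| ≤ a * |x - y| := by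
  have hcl : IsClosed {p : ℝ × ℝ | |f p.1 - f p.2| ≤ a * |p.1 - p.2|} :=
    isClosed_le (by fun_prop) (by fun_prop)
  have hsub : Ioo (-c) c ×ˢ Ioo (-c) c ⊆ {p : ℝ × ℝ | |f p.1 - f p.2| ≤ a * |p.1 - p.2|} :=
    fun p hp => hf.inner _ hp.1 _ hp.2
  have := closure_minimal hsub hcl
  rw [closure_prod_eq, closure_Ioo (by linarith)] at this
  exact fun x hx y hy => this (mk_mem_prod hx hy)

theorem inner_nonneg (hf : FilterCondition f A a c) (hc : 0 < c) : 0 ≤ a := by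
  have := (abs_nonneg _).trans (hf.inner (c / 2) ⟨by linarith, by linarith⟩ 0 ⟨by linarith, hc⟩)
  rw [sub_zero, abs_of_pos (half_pos hc)] at this
  exact nonneg_of_mul_nonneg_left this (half_pos hc)

/-- Between the inner and an outer interval the increment is split at `c` or `-c`, and `a < A`.
Points in opposite outer intervals need no splitting, since `outer` concerns the union. -/
theorem lipschitz_Icc (hf : FilterCondition f A a c) (hcont : Continuous f) (hc : 0 < c)
    (hc1 : c ≤ 1) : ∀ x ∈ Icc (-1 : ℝ) 1, ∀ y ∈ Icc (-1 : ℝ) 1, |f x - f y| ≤ A * |x - y| := by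
  suffices h : ∀ x ∈ Icc (-1 : ℝ) 1, ∀ y ∈ Icc (-1 : ℝ) 1, x ≤ y →
      |f x - f y| ≤ A * |x - y| by
    intro x hx y hy
    rcases le_total x y with hxy | hxy
    · exact h x hx y hy hxy
    · rw [abs_sub_comm, abs_sub_comm x]
      exact h y hy x hx hxy
  intro x hx y hy hxy
  have hin := hf.inner_Icc hcont hc
  have hlt := hf.lt
  have hcc : c ∈ Icc c 1 := ⟨le_rfl, hc1⟩
  have hcc' : -c ∈ Icc (-1) (-c) := ⟨by linarith, le_rfl⟩
  have habs : ∀ p q : ℝ, p ≤ q → |p - q| = q - p := fun p q hpq => by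
    rw [abs_sub_comm, abs_of_nonneg (by linarith)]
  rcases le_or_gt x (-c) with hx1 | hx1
  · rcases le_or_gt y (-c) with hy1 | hy1
    · exact hf.outer _ (Or.inl ⟨hx.1, hx1⟩) _ (Or.inl ⟨hy.1, hy1⟩)
    rcases le_or_gt c y with hy2 | hy2
    · exact hf.outer _ (Or.inl ⟨hx.1, hx1⟩) _ (Or.inr ⟨hy2, hy.2⟩)
    have h1 := hf.outer x (Or.inl ⟨hx.1, hx1⟩) (-c) (Or.inl hcc')
    have h2 := hin (-c) ⟨le_rfl, by linarith⟩ y ⟨hy1.le, hy2.le⟩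
    have h3 := abs_sub_le (f x) (f (-c)) (f y)
    rw [habs x (-c) hx1] at h1
    rw [habs (-c) y hy1.le] at h2
    rw [habs x y hxy]
    nlinarith
  · rcases le_or_gt c x with hx2 | hx2
    · exact hf.outer _ (Or.inr ⟨hx2, hx.2⟩) _ (Or.inr ⟨by linarith, hy.2⟩)
    rcases le_or_gt c y with hy2 | hy2
    · have h1 := hf.outer c (Or.inr hcc) y (Or.inr ⟨hy2, hy.2⟩)
      have h2 := hin x ⟨hx1.le, hx2.le⟩ c ⟨by linarith, le_rfl⟩
      have h3 := abs_sub_le (f x) (f c) (f y)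
      rw [habs c y hy2] at h1
      rw [habs x c hx2.le] at h2
      rw [habs x y hxy]
      nlinarith
    · refine (hin x ⟨hx1.le, hx2.le⟩ y ⟨by linarith, hy2.le⟩).trans ?_
      exact mul_le_mul_of_nonneg_right hlt.le (abs_nonneg _)

end FilterCondition

theorem continuous_spectralResponse {K : ℕ} (h : Fin K → ℝ) : Continuous (spectralResponse h) := by
  unfold spectralResponse
  fun_prop

theorem log_two_mul_div_pos {n : ℕ} {χ : ℝ} (hn : 0 < n) (hχ : 0 < χ) (hχ1 : χ < 1) :
    0 < Real.log (2 * n / χ) := by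
  have hn1 : (1 : ℝ) ≤ n := by exact_mod_cast hn
  refine Real.log_pos ?_
  rw [lt_div_iff₀ hχ]
  linarith

/-- The transfer bound holds as soon as the normalized shift operators are close. -/
theorem transferBound_of_norm_sub_le {K n : ℕ} {h : Fin K → ℝ} {A a c χ : ℝ}
    (hh : FilterCondition (spectralResponse h) A a c) (hc : 0 < c) (hc1 : c ≤ 1) (hn : 0 < n)
    (hχ : 0 < χ) (hχ1 : χ < 1) {G G' : NodeGraph n} (hGG' : ∀ x,
      ‖G.normalizedShift x - G'.normalizedShift x‖ ≤ 2 * √(Real.log (2 * n / χ) / n) * ‖x‖)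
    (x : EuclideanSpace ℝ (Fin n)) : TransferBound h A a c χ G G' x := by
  have ha := hh.inner_nonneg hc
  have hA : 0 ≤ A := ha.trans hh.lt.le
  have hL := log_two_mul_div_pos hn hχ hχ1
  have hε : 0 < 2 * √(Real.log (2 * n / χ) / n) := by positivity
  rw [TransferBound]
  set ε := 2 * √(Real.log (2 * n / χ) / n)
  obtain ⟨v, l, hl, hv⟩ := G.exists_eigenbasis
  obtain ⟨w, m, hm, hw⟩ := G'.exists_eigenbasis
  rw [graphFilter_eq_diagonalOp h G hv, graphFilter_eq_diagonalOp h G' hw]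
  let J : Finset (Fin n) := Finset.univ.filter fun i => c ≤ |m i|
  have hcont := continuous_spectralResponse h
  have hin : ∀ y ∈ Icc (-c) c, |spectralResponse h y - spectralResponse h 0| ≤ a * c := by
    intro y hy
    refine (hh.inner_Icc hcont hc y hy 0 ⟨by linarith, hc.le⟩).trans
      (mul_le_mul_of_nonneg_left ?_ ha)
    rw [sub_zero]
    exact abs_le.2 hy
  have key : ∀ s : ℝ, 0 ≤ s → (∀ i ∈ J, 1 - inner ℝ (v i) (w i) ^ 2 ≤ s ^ 2) →
      ‖diagonalOp v (fun i => spectralResponse h (l i)) x -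
        diagonalOp w (fun i => spectralResponse h (m i)) x‖ ≤
      (A * ε + 2 * J.card * s + 2 * (a * c)) * ‖x‖ := fun s hs hJ =>
    norm_diagonalOp_sub_le v w hc hc1 hs hε.le hA (G.eigenvalue_mem_Icc hv)
      (G'.eigenvalue_mem_Icc hw) (hh.lipschitz_Icc hcont hc hc1) hin hh.bounded
      (abs_eigenvalue_sub_le hv hw hl hm hGG') (fun i hi => by simpa [J] using hi) hJ x
  have hcard : (J.card : ℝ≥0∞) ≤ (G'.inducedGraphon.bandCard c : ℝ≥0∞) := by
    have := ENat.toENNReal_le.2 (G'.card_le_bandCard hm hw hc)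
    rwa [ENat.toENNReal_coe] at this
  -- With `J` empty no eigenvector is compared, so `s = 0` is admissible.
  rcases J.eq_empty_or_nonempty with hJ | ⟨k, hk⟩
  · refine (ENNReal.ofReal_le_ofReal (key 0 le_rfl (by simp [hJ]))).trans ?_
    rw [mul_zero, add_zero, add_mul, ENNReal.ofReal_add (by positivity) (by positivity),
      ENNReal.ofReal_mul (by positivity), ENNReal.ofReal_mul hA, ← mul_assoc 2]
    gcongr
    exact le_self_add
  have hk' : c ≤ |m k| := by simpa [J] using hk
  have hJ1 : (J.card : ℝ≥0∞) ≠ 0 := by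
    simpa using Finset.nonempty_iff_ne_empty.1 ⟨k, hk⟩
  rcases eq_or_ne (G.inducedGraphon.eigenvalueMargin G'.inducedGraphon c) 0 with hδ0 | hδ0
  -- With `δ = 0` the quotient is `⊤`, but `⊤ * 0 = 0` in `ℝ≥0∞`, so `x = 0` is treated apart.
  · rcases eq_or_ne x 0 with rfl | hx
    · simp [diagonalOp]
    · have hB : (G'.inducedGraphon.bandCard c : ℝ≥0∞) ≠ 0 := fun h0 =>
        hJ1 (le_antisymm (h0 ▸ hcard) zero_le)
      have hπ : ENNReal.ofReal Real.pi ≠ 0 := (ENNReal.ofReal_pos.2 Real.pi_pos).ne'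
      have hx' : ENNReal.ofReal ‖x‖ ≠ 0 := (ENNReal.ofReal_pos.2 (norm_pos_iff.2 hx)).ne'
      rw [hδ0, ENNReal.div_zero (mul_ne_zero hπ hB), add_top,
        ENNReal.top_mul (ENNReal.ofReal_pos.2 hε).ne', ENNReal.top_mul hx', top_add]
      exact le_top
  · have hδt := G.eigenvalueMargin_ne_top G' hm hw hc hk'
    set δ := (G.inducedGraphon.eigenvalueMargin G'.inducedGraphon c).toReal with hδ
    have hδpos : 0 < δ := ENNReal.toReal_pos hδ0 hδt
    rw [← ENNReal.ofReal_toReal hδt, ← hδ]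
    have hgap : ∀ i ∈ J, ∀ j, j ≠ i → δ ≤ |m i - l j| := by
      intro i hi j hji
      have := G.eigenvalueMargin_le G' hl hv hm hw hc hji (k := i) (by simpa [J] using hi)
      exact ENNReal.toReal_le_of_le_ofReal (abs_nonneg _) this
    refine (ENNReal.ofReal_le_ofReal (key (ε / δ) (by positivity) fun i hi =>
      one_sub_inner_sq_le hv hw hGG' hδpos i (hgap i hi))).trans ?_
    calc _ ≤ ENNReal.ofReal ((A + Real.pi * J.card / δ) * ε * ‖x‖ + 2 * a * c * ‖x‖) := by
          refine ENNReal.ofReal_le_ofReal ?_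
          have h1 : 2 * J.card * (ε / δ) ≤ Real.pi * J.card / δ * ε := by
            rw [div_mul_eq_mul_div, mul_div_assoc', mul_right_comm, mul_right_comm Real.pi]
            gcongr
            exact Real.two_le_pi
          nlinarith [norm_nonneg x]
      _ = (ENNReal.ofReal A + ENNReal.ofReal Real.pi * J.card / ENNReal.ofReal δ) *
          ENNReal.ofReal ε * ENNReal.ofReal ‖x‖ + ENNReal.ofReal (2 * a * c * ‖x‖) := by
          have hπ := Real.pi_pos
          rw [ENNReal.ofReal_add (by positivity) (by positivity), ENNReal.ofReal_mul (by positivity),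
            ENNReal.ofReal_mul (by positivity), ENNReal.ofReal_add hA (by positivity),
            ENNReal.ofReal_div_of_pos hδpos, ENNReal.ofReal_mul hπ.le, ENNReal.ofReal_natCast]
      _ ≤ _ := by gcongr

/-! ### Concentration of the adjacency matrix of a stochastic graph -/

/-- The adjacency matrices of `G` and `G'` differ by at most `t` in operator norm. -/
def AdjClose {n : ℕ} (t : ℝ) (G G' : NodeGraph n) : Prop :=
  ∀ x, ‖Matrix.toEuclideanLin (G'.adj - G.adj) x‖ ≤ t * ‖x‖

theorem AdjClose.norm_normalizedShift_sub_le {n : ℕ} {L : ℝ} (hn : 0 < n) {G G' : NodeGraph n}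
    (h : AdjClose (2 * √(n * L)) G G') (x : EuclideanSpace ℝ (Fin n)) :
    ‖G.normalizedShift x - G'.normalizedShift x‖ ≤ 2 * √(L / n) * ‖x‖ := by
  have hn' : (0 : ℝ) < n := by exact_mod_cast hn
  have h1 : G'.normalizedShift x - G.normalizedShift x =
      (n : ℝ)⁻¹ • Matrix.toEuclideanLin (G'.adj - G.adj) x := by
    simp only [NodeGraph.normalizedShift, map_smul, map_sub, LinearMap.smul_apply,
      LinearMap.sub_apply, smul_sub]
  have h2 : √(L / n) = (n : ℝ)⁻¹ * √(n * L) := by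
    rw [show L / n = ((n : ℝ)⁻¹) ^ 2 * (n * L) by field_simp, Real.sqrt_mul (sq_nonneg _),
      Real.sqrt_sq (by positivity)]
  rw [norm_sub_rev, h1, norm_smul, h2, Real.norm_eq_abs, abs_of_pos (inv_pos.2 hn')]
  have := mul_le_mul_of_nonneg_left (h x) (inv_pos.2 hn').le
  linarith

theorem measurable_weightedGraph_adj {n : ℕ} (W : Graphon) (i j : Fin n) :
    Measurable fun u : Fin n → I => (weightedGraph W u).adj i j :=
  W.measurable'.comp (f := fun u : Fin n → I => (u i, u j))
    ((measurable_pi_apply i).prodMk (measurable_pi_apply j))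

/-- The condition over all `x` is a bound on the operator norm, a continuous function of the
measurable entries; this avoids an uncountable intersection. -/
theorem measurableSet_centeredPattern_le {n : ℕ} (W : Graphon) (f : NodePair n → Bool) {t : ℝ}
    (ht : 0 ≤ t) : MeasurableSet {u : Fin n → I | ∀ x,
      ‖Matrix.toEuclideanLin (centeredPattern (weightedGraph W u).adj f) x‖ ≤ t * ‖x‖} := by
  let Φ : (Fin n → Fin n → ℝ) →ₗ[ℝ] (EuclideanSpace ℝ (Fin n) →L[ℝ] EuclideanSpace ℝ (Fin n)) :=
    LinearMap.toContinuousLinearMap.toLinearMap ∘ₗ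
      (Matrix.toEuclideanLin (𝕜 := ℝ) (m := Fin n) (n := Fin n)).toLinearMap ∘ₗ
      (Matrix.ofLinearEquiv ℝ).toLinearMap
  have hΦ : Continuous Φ := LinearMap.continuous_of_finiteDimensional _
  let M : (Fin n → I) → Fin n → Fin n → ℝ := fun u i j =>
    centeredPattern (weightedGraph W u).adj f i j
  have hm : Measurable M := by
    refine measurable_pi_iff.2 fun i => measurable_pi_iff.2 fun j => ?_
    exact (measurable_weightedGraph_adj W i j).const_sub _
  have : {u : Fin n → I | ∀ x,
      ‖Matrix.toEuclideanLin (centeredPattern (weightedGraph W u).adj f) x‖ ≤ t * ‖x‖} =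
      {u | ‖Φ (M u)‖ ≤ t} := by
    ext u
    exact (ContinuousLinearMap.opNorm_le_iff (f := Φ (M u)) ht).symm
  rw [this]
  exact measurableSet_le (hΦ.norm.measurable.comp hm) measurable_const

section StochasticGraph

variable {Ω : Type*} [MeasurableSpace Ω] {P : Measure Ω} {n : ℕ} {W : Graphon}
  {U : Ω → Fin n → I} {G : Ω → NodeGraph n}

theorem IsUniformSample.measurable' (hU : IsUniformSample P U) : Measurable U :=
  measurable_pi_iff.2 hU.measurable

/-- The joint law of the labels and the pattern of the upper triangle of a stochastic graph. -/
theorem IsStochasticGraph.measure_pattern (hG : IsStochasticGraph P W U G)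
    {A : Set (Fin n → I)} (hA : MeasurableSet A) (f : NodePair n → Bool) :
    P {ω | U ω ∈ A ∧ ∀ p : NodePair n, (G ω).adj p.1.1 p.1.2 = if f p then 1 else 0} =
      ∫⁻ ω in U ⁻¹' A, ENNReal.ofReal (bernoulliWeight
        (fun p : NodePair n => (weightedGraph W (U ω)).adj p.1.1 p.1.2) f) ∂P := by
  -- The values below the diagonal are irrelevant; `false` is a filler.
  have h := hG.bernoulli A hA fun i j => if hij : i ≤ j then f ⟨(i, j), hij⟩ else false
  have hset : {ω | U ω ∈ A ∧ ∀ p : NodePair n, (G ω).adj p.1.1 p.1.2 = if f p then 1 else 0} =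
      {ω | U ω ∈ A ∧ ∀ i j, i ≤ j → (G ω).adj i j =
        if (if hij : i ≤ j then f ⟨(i, j), hij⟩ else false) = true then 1 else 0} := by
    ext ω
    refine and_congr_right fun _ => ⟨fun H i j hij => ?_, fun H p => ?_⟩
    · rw [dif_pos hij]
      exact H ⟨(i, j), hij⟩
    · have := H p.1.1 p.1.2 p.2
      rwa [dif_pos p.2] at this
  rw [hset, h]
  refine lintegral_congr fun ω => ?_
  rw [bernoulliWeight, ENNReal.ofReal_prod_of_nonneg]
  · rw [Finset.prod_subtype (p := fun p : Fin n × Fin n => p.1 ≤ p.2) _ (by simp)]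
    refine Finset.prod_congr rfl fun p _ => ?_
    rw [dif_pos p.2]
  · intro p _
    have := (weightedGraph W (U ω)).mem' p.1.1 p.1.2
    split_ifs
    · exact this.1
    · linarith [this.2]

theorem IsStochasticGraph.exists_pattern (hG : IsStochasticGraph P W U G) (ω : Ω) :
    ∃ f : NodePair n → Bool,
      (∀ p : NodePair n, (G ω).adj p.1.1 p.1.2 = if f p then 1 else 0) ∧
      (G ω).adj - (weightedGraph W (U ω)).adj = centeredPattern (weightedGraph W (U ω)).adj f := by
  classical
  have hf : ∀ i j, (G ω).adj i j = if decide ((G ω).adj i j = 1) then 1 else 0 := by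
    intro i j
    rcases hG.unweighted ω i j with h | h <;> simp [h]
  refine ⟨fun p => decide ((G ω).adj p.1.1 p.1.2 = 1), fun p => hf _ _, ?_⟩
  ext i j
  rw [centeredPattern, ← hf, Matrix.sub_apply]
  rcases le_total i j with h | h
  · simp only [min_eq_left h, max_eq_right h]
  · simp only [min_eq_right h, max_eq_left h, (G ω).symm' i j]

-- Once the pattern `f` is fixed, closeness is a condition `D f` on the labels alone, so the joint
-- law applies to the label event `D f ∩ A`. Summing over patterns and integrating the bound for
-- fixed labels gives the claim.
open Classical in
theorem IsStochasticGraph.measure_not_adjClose_le (hG : IsStochasticGraph P W U G)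
    (hU : IsUniformSample P U) (hn : 0 < n) {χ : ℝ} (hχ : 0 < χ) (hχ1 : χ < 1)
    {A : Set (Fin n → I)} (hA : MeasurableSet A) :
    P {ω | U ω ∈ A ∧ ¬ AdjClose (2 * √(n * Real.log (2 * n / χ))) (weightedGraph W (U ω)) (G ω)} ≤
      ENNReal.ofReal χ * P (U ⁻¹' A) := by
  have ht : 0 ≤ 2 * √(n * Real.log (2 * n / χ)) := by positivity
  set t := 2 * √(n * Real.log (2 * n / χ)) with htdef
  have hUm := hU.measurable'
  let D : (NodePair n → Bool) → Set (Fin n → I) := fun f => {u | ∀ x,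
    ‖Matrix.toEuclideanLin (centeredPattern (weightedGraph W u).adj f) x‖ ≤ t * ‖x‖}ᶜ
  have hD : ∀ f, MeasurableSet (D f) := fun f => (measurableSet_centeredPattern_le W f ht).compl
  let p : (NodePair n → Bool) → Ω → ℝ≥0∞ := fun f ω => ENNReal.ofReal (bernoulliWeight
    (fun p : NodePair n => (weightedGraph W (U ω)).adj p.1.1 p.1.2) f)
  have hp : ∀ f, Measurable (p f) := by
    intro f
    refine Measurable.ennreal_ofReal (Finset.measurable_prod _ fun q _ => ?_)
    have := (measurable_weightedGraph_adj W q.1.1 q.1.2).comp hUm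
    split_ifs
    · exact this
    · exact this.const_sub 1
  calc _ ≤ P (⋃ f ∈ (Finset.univ : Finset (NodePair n → Bool)), {ω | U ω ∈ D f ∩ A ∧
        ∀ q : NodePair n, (G ω).adj q.1.1 q.1.2 = if f q then 1 else 0}) := by
        refine measure_mono ?_
        rintro ω ⟨hωA, hω⟩
        obtain ⟨f, hf, hf'⟩ := hG.exists_pattern ω
        rw [AdjClose, hf'] at hω
        exact mem_biUnion (Finset.mem_coe.2 (Finset.mem_univ f)) ⟨⟨hω, hωA⟩, hf⟩
    _ ≤ ∑ f, ∫⁻ ω in U ⁻¹' A, (U ⁻¹' D f).indicator (p f) ω ∂P := by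
        refine (measure_biUnion_finset_le _ _).trans_eq (Finset.sum_congr rfl fun f _ => ?_)
        rw [hG.measure_pattern ((hD f).inter hA), lintegral_indicator (hUm (hD f)),
          Measure.restrict_restrict (hUm (hD f)), preimage_inter]
    _ = ∫⁻ ω in U ⁻¹' A, ∑ f, (U ⁻¹' D f).indicator (p f) ω ∂P :=
        (lintegral_finsetSum _ fun f _ => (hp f).indicator (hUm (hD f))).symm
    _ ≤ ∫⁻ _ in U ⁻¹' A, ENNReal.ofReal χ ∂P := by
        refine lintegral_mono fun ω => ?_
        have := sum_bernoulliWeight_filter_le hn (weightedGraph W (U ω)).symm'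
          (weightedGraph W (U ω)).mem' hχ hχ1
        rw [Finset.sum_filter] at this
        refine le_trans (Finset.sum_le_sum fun f _ => ?_) this
        rw [indicator_apply]
        exact le_of_eq (if_congr Iff.rfl rfl rfl)
    _ = _ := setLIntegral_const _ _

/-- Passing to the complement by subadditivity requires no measurability of the closeness event. -/
theorem IsStochasticGraph.mul_measure_le_measure_adjClose [IsProbabilityMeasure P]
    (hG : IsStochasticGraph P W U G)
    (hU : IsUniformSample P U) (hn : 0 < n) {χ : ℝ} (hχ : 0 < χ) (hχ1 : χ < 1)
    {A : Set (Fin n → I)} (hA : MeasurableSet A) :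
    ENNReal.ofReal (1 - χ) * P (U ⁻¹' A) ≤ P (U ⁻¹' A ∩
      {ω | AdjClose (2 * √(n * Real.log (2 * n / χ))) (weightedGraph W (U ω)) (G ω)}) := by
  have h1 := hG.measure_not_adjClose_le hU hn hχ hχ1 hA
  have hfin : ENNReal.ofReal χ * P (U ⁻¹' A) ≠ ⊤ :=
    ENNReal.mul_ne_top ENNReal.ofReal_ne_top (measure_ne_top _ _)
  rw [ENNReal.ofReal_sub _ hχ.le, ENNReal.ofReal_one, ENNReal.sub_mul fun _ _ => measure_ne_top _ _,
    one_mul, tsub_le_iff_right]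
  refine le_trans ?_ (add_le_add_right h1 _)
  refine (measure_mono fun ω hω => ?_).trans (measure_union_le _ _)
  by_cases h : AdjClose (2 * √(n * Real.log (2 * n / χ))) (weightedGraph W (U ω)) (G ω)
  · exact Or.inl ⟨hω, h⟩
  · exact Or.inr ⟨hω, h⟩

end StochasticGraph

theorem Graphon.IsLipschitz.nonneg {W : Graphon} {A : ℝ} (hW : W.IsLipschitz A) : 0 ≤ A := by
  simpa using (abs_nonneg _).trans (hW 0 0 1 0)

theorem SizeCondition.pos {W : Graphon} {A χ : ℝ} {n : ℕ} (h : SizeCondition W A χ n)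
    (hA : 0 ≤ A) : 0 < n := by
  rcases Nat.eq_zero_or_pos n with rfl | hn
  -- For `n = 0` the logarithm is `log 0 = 0`, so the condition reads `0 > 2 A / d_W`.
  · have h1 := h.2
    have h2 := div_nonneg hA h.1.le
    simp at h1
    linarith
  · exact hn

end

theorem lemma1 {Ω : Type*} [MeasurableSpace Ω] (P : Measure Ω) [IsProbabilityMeasure P]
    (W : Graphon) (A_w : ℝ) (hW : W.IsLipschitz A_w)
    (X : unitInterval → ℝ) (A_x : ℝ) (hX : SignalIsLipschitz X A_x)
    (χ₃ : ℝ) (hχ : χ₃ ∈ Set.Ioo (0 : ℝ) 1)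
    (c : ℝ) (hc : c ∈ Set.Ioc (0 : ℝ) 1)
    (K : ℕ) (h : Fin K → ℝ) (A_h a_h : ℝ)
    (hh : FilterCondition (spectralResponse h) A_h a_h c)
    (n : ℕ) (hn : SizeCondition W A_w χ₃ n)
    (U : Ω → Fin n → unitInterval) (hU : IsUniformSample P U)
    (G : Ω → NodeGraph n) (hG : IsStochasticGraph P W U G) :
    ENNReal.ofReal (1 - χ₃) ≤
      P {ω | TransferBound h A_h a_h c χ₃ (weightedGraph W (U ω)) (G ω)
        (graphSignal X (U ω))} ∧
    -- the same lower bound conditionally on every label event of positive probability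
    ∀ A : Set (Fin n → unitInterval), MeasurableSet A → P {ω | U ω ∈ A} ≠ 0 →
      ENNReal.ofReal (1 - χ₃) ≤
        (ProbabilityTheory.cond P {ω | U ω ∈ A})
          {ω | TransferBound h A_h a_h c χ₃ (weightedGraph W (U ω)) (G ω)
            (graphSignal X (U ω))} := by
  have hn0 : 0 < n := hn.pos hW.nonneg
  have hχ0 : 0 < χ₃ := hχ.1
  -- The product form serves both claims: `A = univ` gives the unconditional bound, division by the
  -- probability of the label event the conditional one.
  have key : ∀ A : Set (Fin n → unitInterval), MeasurableSet A →
      ENNReal.ofReal (1 - χ₃) * P {ω | U ω ∈ A} ≤ P ({ω | U ω ∈ A} ∩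
        {ω | TransferBound h A_h a_h c χ₃ (weightedGraph W (U ω)) (G ω)
          (graphSignal X (U ω))}) := by
    intro A hA
    refine (hG.mul_measure_le_measure_adjClose hU hn0 hχ0 hχ.2 hA).trans (measure_mono ?_)
    exact Set.inter_subset_inter_right _ fun ω hω => transferBound_of_norm_sub_le hh hc.1 hc.2 hn0
      hχ0 hχ.2 (AdjClose.norm_normalizedShift_sub_le hn0 hω) _
  refine ⟨?_, fun A hA hA0 => ?_⟩
  · have := key Set.univ MeasurableSet.univ
    simpa using this
  · have hm : MeasurableSet {ω | U ω ∈ A} := hU.measurable' hA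
    rw [ProbabilityTheory.cond_apply hm, mul_comm, ← div_eq_mul_inv,
      ENNReal.le_div_iff_mul_le (Or.inl hA0) (Or.inl (measure_ne_top _ _))]
    exact key A hA
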